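/- Let $\tau=\frac{1+\sqrt5}{2}$ and $r_1=\cos\frac{\pi}{10}$. A distance graph $G=(V,E)$ is a set $V\subset\mathbb{R}^3$ with a set $E$ of pairs of points of $V$ at distance $1$; $\operatorname{udg}(V)$ is the distance graph on $V$ in which all pairs at distance $1$ are edges. For distance graphs $G_1=(V_1,E_1)$, $G_2=(V_2,E_2)$ on a sphere centred at the origin, let $\mathcal F(G_1,G_2)\subset O(3)$ be the set of all $f$ for which there are edges $u_1v_1\in E_1$ and $u_2v_2\in E_2$ with $f(\{u_2,v_2\})=\{u_1,v_1\}$, and define the distance product $$G_1\circ G_2=\operatorname{udg}\Bigl(\bigcup_{f\in\mathcal F(G_1,G_2)}f(V_2)\Bigr).$$ Let $H_{12,1}=\operatorname{udg}(V)$, where $V$ is the set of the 12 vertices $(0,\pm\frac\tau2,\pm\frac12)$, $(\pm\frac\tau2,\pm\frac12,0)$, $(\pm\frac12,0,\pm\frac\tau2)$ of the icosahedron with unit edges. Let $L_{9,1}$ be the graph on $\{0,\dots,8\}$ with the 15 edges $01,02,03,04,05,12,23,34,45,67,68,78,36,17,58$ (the Golomb graph without a vertex of degree $3$ of its hexagonal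 rim). With $s=\sqrt{2\sqrt5-1}$ and $z=\sqrt{\bigl(5-3\sqrt5+(1+\sqrt5)s\bigr)/4}$, let $H_{9,1}$ be the distance graph obtained from $L_{9,1}$ by placing the vertices $0,\dots,5$ at $$\left(\tfrac\tau2,\tfrac12,0\right),\ \left(0,\tfrac\tau2,\tfrac12\right),\ \left(\tfrac12,0,\tfrac\tau2\right),\ \left(\tfrac\tau2,-\tfrac12,0\right),\ \left(\tfrac12,0,-\tfrac\tau2\right),\ \left(0,\tfrac\tau2,-\tfrac12\right),$$ the vertex $6$ at $\left(\frac{1+s}{4},\frac{(1+\sqrt5)(s-1)}{8},\frac z2\right)\approx(0.71584,0.34924,0.51972)$, and the vertices $7$ and $8$ at $$\tfrac1{16}\left(a+2(\sqrt5-s)z,\ 2+2s-bz,\ c+dz\right)\approx(-0.07961,-0.08345,0.94404),$$ $$\tfrac1{16}\left(a-2(\sqrt5-s)z,\ 2+2s+bz,\ -c+dz\right)\approx(-0.17646,0.79929,0.48426),$$ where $a=1+3\sqrt5-(3+\sqrt5)s$, $b=3-\sqrt5+(1+\sqrt5)s$, $c=3+3\sqrt5-(1+\sqrt5)s$, $d=-1+\sqrt5+(3+\sqrt5)s$.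 Then the nine points are distinct and lie on the sphere $S^2(r_1)$ of radius $r_1$ centred at the origin (and all 15 edges have length $1$), so that $H_{9,1}$ is an embedding of $L_{9,1}$ in $S^2(r_1)$ as a unit distance graph. The distance product $H_{12,1}\circ H_{9,1}$ lies on $S^2(r_1)$, has $732$ vertices and $3390$ edges, and $$\chi(H_{12,1}\circ H_{9,1})=5.$$ Let $G_{372}$ be the subgraph of $H_{12,1}\circ H_{9,1}$ that remains when the vertices of degree $7$ and less are discarded. Then $G_{372}$ has $372$ vertices, $1710$ edges and minimum degree at least $8$, its vertex set is preserved by every isometry $f\in O(3)$ that preserves the icosahedron, and $\chi(G_{372})=5$. -/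

import Mathlib

open scoped goldenRatio

noncomputable section

/-- Three-dimensional Euclidean space. -/
abbrev E3 : Type := EuclideanSpace ℝ (Fin 3)

/-- The unit distance graph on all of `ℝ³`. -/
def unitGraph : SimpleGraph E3 where
  Adj u v := dist u v = 1
  symm := ⟨fun u v h => by rw [dist_comm]; exact h⟩
  loopless := ⟨fun u h => by simp at h⟩

/-- A distance graph `(V, E)`: a set `V` of points together with a set `E` of pairs of points of `V`
at distance one (not necessarily all such pairs). -/
abbrev DistGraph : Type := unitGraph.Subgraph

/-- The (faithful) unit distance graph with vertex set `V`: all pairs at distance one are edges. -/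
def udg (V : Set E3) : DistGraph := (⊤ : unitGraph.Subgraph).induce V

/-- The isometries, fixing the origin, that carry the pair `{u₂, v₂}` onto the pair `{u₁, v₁}`. -/
def pairIsometries (u₁ v₁ u₂ v₂ : E3) : Set (E3 ≃ₗᵢ[ℝ] E3) :=
  {f | (f u₂ = u₁ ∧ f v₂ = v₁) ∨ (f u₂ = v₁ ∧ f v₂ = u₁)}

/-- The isometries that glue some edge of `G₂` onto some edge of `G₁`. -/
def gluingIsometries (G₁ G₂ : DistGraph) : Set (E3 ≃ₗᵢ[ℝ] E3) :=
  {f | ∃ u₁ v₁ u₂ v₂ : E3, G₁.Adj u₁ v₁ ∧ G₂.Adj u₂ v₂ ∧ f ∈ pairIsometries u₁ v₁ u₂ v₂}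

/-- The distance product `G₁ ∘ G₂` of two distance graphs on a sphere centred at the origin. -/
def distanceProduct (G₁ G₂ : DistGraph) : DistGraph :=
  udg (⋃ f ∈ gluingIsometries G₁ G₂, (fun x => f x) '' G₂.verts)

/-- The vertices of the icosahedron with unit edges centred at the origin. -/
def icosahedronVertices : Set E3 :=
  {p | ∃ a b : ℝ, (a = 1 ∨ a = -1) ∧ (b = 1 ∨ b = -1) ∧
    (p = !₂[0, a * (φ / 2), b * (1 / 2)] ∨
     p = !₂[a * (φ / 2), b * (1 / 2), 0] ∨
     p = !₂[a * (1 / 2), 0, b * (φ / 2)])}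

/-- The unit icosahedron graph. -/
def H121 : DistGraph := udg icosahedronVertices

/-- The radius of the circumscribed sphere of the icosahedron with unit edges. -/
def r₁ : ℝ := Real.cos (Real.pi / 10)

/-- The abstract graph `L₉,₁`, on 9 vertices with 15 edges: the Golomb graph without one of the three
vertices of degree three of its hexagonal rim. Vertex `0` is joined to each vertex
of the path `1 2 3 4 5` (this gives four triangles with a common vertex), and the triangle
`6 7 8` is attached to the path by the edges `3 6`, `1 7` and `5 8`. -/
def L91 : SimpleGraph (Fin 9) :=
  SimpleGraph.fromEdgeSet
    {s(0, 1), s(0, 2), s(0, 3), s(0, 4), s(0, 5),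
     s(1, 2), s(2, 3), s(3, 4), s(4, 5),
     s(6, 7), s(6, 8), s(7, 8),
     s(3, 6), s(1, 7), s(5, 8)}

/-- The number `√(2√5 - 1)`. -/
def sG : ℝ := √(2 * √5 - 1)

/-- The number `√((5 - 3√5 + (1 + √5) √(2√5 - 1)) / 4)`, equal to `1.03944...`. -/
def zG : ℝ := √((5 - 3 * √5 + (1 + √5) * sG) / 4)

/-- The embedding of `L₉,₁`. The vertices `0, …, 5` are a pentagonal cap of the icosahedron. The
vertices `6, 7, 8` are, numerically,
`(0.71584, 0.34924, 0.51972)`, `(-0.07961, -0.08345, 0.94404)`, `(-0.17646, 0.79929, 0.48426)`. -/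
def pt91 : Fin 9 → E3 :=
  ![!₂[φ / 2, 1 / 2, 0],
    !₂[0, φ / 2, 1 / 2],
    !₂[1 / 2, 0, φ / 2],
    !₂[φ / 2, -(1 / 2), 0],
    !₂[1 / 2, 0, -(φ / 2)],
    !₂[0, φ / 2, -(1 / 2)],
    !₂[(1 + sG) / 4,
       (1 + √5) * (sG - 1) / 8,
       zG / 2],
    !₂[(1 + 3 * √5 - (3 + √5) * sG + 2 * (√5 - sG) * zG) / 16,
       (2 + 2 * sG - (3 - √5 + (1 + √5) * sG) * zG) / 16,
       (3 + 3 * √5 - (1 + √5) * sG + (-1 + √5 + (3 + √5) * sG) * zG) / 16],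
    !₂[(1 + 3 * √5 - (3 + √5) * sG - 2 * (√5 - sG) * zG) / 16,
       (2 + 2 * sG + (3 - √5 + (1 + √5) * sG) * zG) / 16,
       (-(3 + 3 * √5) + (1 + √5) * sG + (-1 + √5 + (3 + √5) * sG) * zG) / 16]]

theorem sq_sG : sG ^ 2 = 2 * √5 - 1 := by
  have h : (1 : ℝ) ≤ √5 := Real.one_le_sqrt.2 (by norm_num)
  exact Real.sq_sqrt (by linarith)

theorem sq_zG : zG ^ 2 = (5 - 3 * √5 + (1 + √5) * sG) / 4 := by
  have h5 : √5 ^ 2 = (5 : ℝ) := Real.sq_sqrt (by norm_num)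
  have h : (2 : ℝ) ≤ √5 := Real.le_sqrt_of_sq_le (by norm_num)
  have h' : √5 ≤ (3 : ℝ) := Real.sqrt_le_iff.2 (by norm_num)
  have hs : (√5 - 1 : ℝ) ≤ sG := Real.le_sqrt_of_sq_le (by nlinarith)
  refine Real.sq_sqrt ?_
  nlinarith [mul_le_mul_of_nonneg_left hs (show (0 : ℝ) ≤ 1 + √5 by linarith)]

/-- The endpoints of every edge of `L₉,₁` are embedded at distance one. -/
theorem dist_pt91 {i j : Fin 9} (h : L91.Adj i j) : unitGraph.Adj (pt91 i) (pt91 j) := by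
  have key : ∀ x y z x' y' z' : ℝ, (x - x') ^ 2 + (y - y') ^ 2 + (z - z') ^ 2 = 1 →
      unitGraph.Adj (!₂[x, y, z] : E3) (!₂[x', y', z'] : E3) := by
    intro x y z x' y' z' h
    change dist _ _ = 1
    rw [EuclideanSpace.dist_eq, Real.sqrt_eq_one, Fin.sum_univ_three]
    simpa [Real.dist_eq, sq_abs] using h
  have h5 : √5 ^ 2 = (5 : ℝ) := Real.sq_sqrt (by norm_num)
  have hs := sq_sG
  have hz := sq_zG
  have hφ : φ = (1 + √5) / 2 := rfl
  rw [L91, SimpleGraph.fromEdgeSet_adj] at h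
  replace h := h.1
  simp only [Set.mem_insert_iff, Set.mem_singleton_iff, Sym2.eq_iff] at h
  rcases h with h | h | h | h | h | h | h | h | h | h | h | h | h | h | h <;>
    rcases h with ⟨rfl, rfl⟩ | ⟨rfl, rfl⟩ <;>
    apply key <;> (try simp only [hφ]) <;> clear key hφ <;> grind

/-- The distance graph `H₉,₁`: the graph `L₉,₁`, with its 15 edges, placed in space. -/
def H91 : DistGraph :=
  (⊤ : L91.Subgraph).map ⟨pt91, dist_pt91⟩

/-- The graph `H₁₂,₁ ∘ H₉,₁`. -/
def productGraph : DistGraph := distanceProduct H121 H91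

/-- The graph `G₃₇₂`: what remains of `H₁₂,₁ ∘ H₉,₁` when the vertices of degree at most 7 are
discarded. -/
def G372 : DistGraph :=
  productGraph.deleteVerts {v | (productGraph.neighborSet v).encard ≤ 7}

end

/-! All points have coordinates in `ℤ[√5, s, y]` scaled by 1/32, where `y = 2z`. The eight products
of `√5`, `s`, `y` are linearly independent over the rationals: at each of the two upper floors of
the tower some conjugate of the radicand is negative. So an equality between such real numbers, in
particular "distance one", is an equality of eight integers (`K8.ev_injective`), and the kernel can
decide it.

The sign changes and cyclic shifts of the coordinates form a group of order 24 that preserves the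
icosahedron. Under it, 732 explicit points fall into the 12 icosahedron vertices and 30 regular
orbits, so distances need only be computed from 31 base points (`mem_nbrs`).

These points are exactly the vertices of the product (`mem_productGraph_iff`). Each is a vertex,
because a triple of points of `H91` congruent to an icosahedron edge and a base point yields a
gluing isometry. Conversely, up to the group there are two icosahedron edges to glue to; an isometry
known on an edge leaves two positions for any further vertex, and all these positions occur in the
list.

The points are numbered by decreasing degree, so `G372` consists of the points below 372; degrees
and edge numbers are then counted. An isometry preserving the icosahedron carries gluings to
gluings, hence preserves the product, the degrees and `G372`.

An explicit colouring gives at most five colours. For the lower bound, a 4-colouring of `G372`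
restricts to the icosahedron, where up to the group and permutations of the colours there are only
two (`icosahedron_colorings`). A verified search with propagation of forced colours shows that
neither extends (`refute_coloringA`, `refute_coloringB`). -/

/-! ### The ring `ℤ[√5, s, y]` with `s² = 2√5 - 1` and `y² = 5 - 3√5 + (1 + √5) s` -/

/-- The number `a + b √5`. -/
@[ext] structure Z5 where
  a : ℤ
  b : ℤ
deriving DecidableEq

/-- The number `a + b s`. -/
@[ext] structure K4 where
  a : Z5
  b : Z5
deriving DecidableEq

/-- The number `a + b y`. -/
@[ext] structure K8 where
  a : K4
  b : K4
deriving DecidableEq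

namespace Z5
instance : Zero Z5 := ⟨⟨0, 0⟩⟩
instance : Neg Z5 := ⟨fun x => ⟨Int.neg x.a, Int.neg x.b⟩⟩

/-- Addition. -/
def add (x y : Z5) : Z5 := ⟨Int.add x.a y.a, Int.add x.b y.b⟩

/-- Subtraction. -/
def sub (x y : Z5) : Z5 := ⟨Int.sub x.a y.a, Int.sub x.b y.b⟩

/-- Multiplication. -/
def mul (x y : Z5) : Z5 :=
  ⟨Int.add (Int.mul x.a y.a) (Int.mul 5 (Int.mul x.b y.b)),
    Int.add (Int.mul x.a y.b) (Int.mul x.b y.a)⟩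

instance : Add Z5 := ⟨add⟩
instance : Sub Z5 := ⟨sub⟩
instance : Mul Z5 := ⟨mul⟩

variable {A : Type*} [CommRing A]

/-- The value of `a + b √5` when `√5` is interpreted as `q`. -/
def ev (q : A) (x : Z5) : A := x.a + x.b * q

variable {q : A}

theorem ev_zero : ev q 0 = 0 := by
  change ((0 : ℤ) : A) + ((0 : ℤ) : A) * q = 0
  simp

theorem ev_neg (x : Z5) : ev q (-x) = -ev q x := by
  change ((-x.a : ℤ) : A) + ((-x.b : ℤ) : A) * q = -(x.a + x.b * q)
  push_cast; ring

theorem ev_add (x y : Z5) : ev q (x + y) = ev q x + ev q y := by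
  change ((x.a + y.a : ℤ) : A) + ((x.b + y.b : ℤ) : A) * q = (x.a + x.b * q) + (y.a + y.b * q)
  push_cast; ring

theorem ev_sub (x y : Z5) : ev q (x - y) = ev q x - ev q y := by
  change ((x.a - y.a : ℤ) : A) + ((x.b - y.b : ℤ) : A) * q = (x.a + x.b * q) - (y.a + y.b * q)
  push_cast; ring

theorem ev_mul (hq : q ^ 2 = 5) (x y : Z5) : ev q (x * y) = ev q x * ev q y := by
  change ((x.a * y.a + 5 * (x.b * y.b) : ℤ) : A) + ((x.a * y.b + x.b * y.a : ℤ) : A) * q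
    = (x.a + x.b * q) * (y.a + y.b * q)
  push_cast
  linear_combination (-(x.b * y.b : A)) * hq

/-- Both square roots of 5 are admitted because the next floor of the tower needs the conjugate
`-√5`. -/
theorem eq_zero_of_ev {q : ℝ} (hq : q ^ 2 = 5) {x : Z5} (h : ev q x = 0) : x = 0 := by
  have hirr : Irrational q := by
    have h5 : Irrational (√5 : ℝ) := by
      simpa using (show Nat.Prime 5 by norm_num).irrational_sqrt
    have : (q - √5) * (q + √5) = 0 := by
      linear_combination hq - Real.sq_sqrt (show (0 : ℝ) ≤ 5 by norm_num)
    rcases mul_eq_zero.1 this with h | h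
    · rwa [sub_eq_zero.1 h]
    · rw [eq_neg_of_add_eq_zero_left h]; exact h5.neg
  have hb : x.b = 0 := by
    by_contra hb
    refine (hirr.intCast_mul hb).ne_int (-x.a) ?_
    unfold ev at h
    push_cast
    linarith
  have ha : x.a = 0 := by
    unfold ev at h
    rw [hb] at h
    simpa using h
  exact Z5.ext ha hb
end Z5

namespace K4
instance : Zero K4 := ⟨⟨0, 0⟩⟩
instance : Neg K4 := ⟨fun x => ⟨-x.a, -x.b⟩⟩

/-- Addition. -/
def add (x y : K4) : K4 := ⟨x.a.add y.a, x.b.add y.b⟩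

/-- Subtraction. -/
def sub (x y : K4) : K4 := ⟨x.a.sub y.a, x.b.sub y.b⟩

/-- Multiplication. -/
def mul (x y : K4) : K4 :=
  ⟨(x.a.mul y.a).add (Z5.mul ⟨-1, 2⟩ (x.b.mul y.b)), (x.a.mul y.b).add (x.b.mul y.a)⟩

instance : Add K4 := ⟨add⟩
instance : Sub K4 := ⟨sub⟩
instance : Mul K4 := ⟨mul⟩

variable {A : Type*} [CommRing A]

/-- The value of `a + b s`. -/
def ev (q s : A) (x : K4) : A := x.a.ev q + x.b.ev q * s

variable {q s : A}

theorem ev_zero : ev q s 0 = 0 := by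
  change Z5.ev q 0 + Z5.ev q 0 * s = 0
  simp [Z5.ev_zero]

theorem ev_neg (x : K4) : ev q s (-x) = -ev q s x := by
  change Z5.ev q (-x.a) + Z5.ev q (-x.b) * s = -(x.a.ev q + x.b.ev q * s)
  simp only [Z5.ev_neg]; ring

theorem ev_add (x y : K4) : ev q s (x + y) = ev q s x + ev q s y := by
  change Z5.ev q (x.a + y.a) + Z5.ev q (x.b + y.b) * s
    = (x.a.ev q + x.b.ev q * s) + (y.a.ev q + y.b.ev q * s)
  simp only [Z5.ev_add]; ring

theorem ev_sub (x y : K4) : ev q s (x - y) = ev q s x - ev q s y := by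
  change Z5.ev q (x.a - y.a) + Z5.ev q (x.b - y.b) * s
    = (x.a.ev q + x.b.ev q * s) - (y.a.ev q + y.b.ev q * s)
  simp only [Z5.ev_sub]; ring

theorem ev_mul (hq : q ^ 2 = 5) (hs : s ^ 2 = 2 * q - 1) (x y : K4) :
    ev q s (x * y) = ev q s x * ev q s y := by
  change Z5.ev q (x.a * y.a + ⟨-1, 2⟩ * (x.b * y.b)) + Z5.ev q (x.a * y.b + x.b * y.a) * s
    = (x.a.ev q + x.b.ev q * s) * (y.a.ev q + y.b.ev q * s)
  simp only [Z5.ev_add, Z5.ev_mul hq]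
  have : Z5.ev q ⟨-1, 2⟩ = 2 * q - 1 := by simp [Z5.ev]; ring
  rw [this]
  linear_combination (-(x.b.ev q * y.b.ev q)) * hs

/-- The norm `a² - (2√5 - 1) b²` vanishes in `Z5`, hence also after `√5 ↦ -√5`. There it reads `a'²
+ (2√5 + 1) b'²`, a sum of nonnegative terms, which forces `b = 0`. Either sign of `s` is admitted,
for use one floor higher. -/
theorem eq_zero_of_ev {s : ℝ} (hs : s ^ 2 = 2 * √5 - 1) {x : K4} (h : ev √5 s x = 0) : x = 0 := by
  have hq : (√5 : ℝ) ^ 2 = 5 := Real.sq_sqrt (by norm_num)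
  have hq' : (-√5 : ℝ) ^ 2 = 5 := by rw [neg_sq, hq]
  have h1 : x.a * x.a - x.b * x.b * ⟨-1, 2⟩ = 0 := by
    refine Z5.eq_zero_of_ev hq ?_
    have : Z5.ev √5 ⟨-1, 2⟩ = 2 * √5 - 1 := by simp [Z5.ev]; ring
    rw [Z5.ev_sub, Z5.ev_mul hq, Z5.ev_mul hq, Z5.ev_mul hq, this]
    unfold ev at h
    linear_combination (x.a.ev √5 - x.b.ev √5 * s) * h + (x.b.ev √5) ^ 2 * hs
  have h2 := congrArg (Z5.ev (-√5)) h1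
  have : Z5.ev (-√5) ⟨-1, 2⟩ = -(2 * √5 + 1) := by simp [Z5.ev]
  rw [Z5.ev_sub, Z5.ev_mul hq', Z5.ev_mul hq', Z5.ev_mul hq', this, Z5.ev_zero] at h2
  have h5 : 0 ≤ √5 := Real.sqrt_nonneg 5
  have hb : x.b.ev (-√5) = 0 := by
    nlinarith [sq_nonneg (x.a.ev (-√5)), sq_nonneg (x.b.ev (-√5)),
      mul_nonneg (sq_nonneg (x.b.ev (-√5))) h5]
  have hb := Z5.eq_zero_of_ev hq' hb
  have ha : x.a = 0 := by
    refine Z5.eq_zero_of_ev hq ?_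
    unfold ev at h
    rwa [hb, Z5.ev_zero, zero_mul, add_zero] at h
  exact K4.ext ha hb
end K4

namespace K8
instance : Zero K8 := ⟨⟨0, 0⟩⟩
instance : Neg K8 := ⟨fun x => ⟨-x.a, -x.b⟩⟩

/-- Addition. -/
def add (x y : K8) : K8 := ⟨x.a.add y.a, x.b.add y.b⟩

/-- Subtraction. -/
def sub (x y : K8) : K8 := ⟨x.a.sub y.a, x.b.sub y.b⟩

/-- Multiplication. -/
def mul (x y : K8) : K8 :=
  ⟨(x.a.mul y.a).add (K4.mul ⟨⟨5, -3⟩, ⟨1, 1⟩⟩ (x.b.mul y.b)), (x.a.mul y.b).add (x.b.mul y.a)⟩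

instance : Add K8 := ⟨add⟩
instance : Sub K8 := ⟨sub⟩
instance : Mul K8 := ⟨mul⟩

/-- The element with the given coefficients at `1, √5, s, √5 s, y, √5 y, s y, √5 s y`. -/
def mk8 (a b c d e f g h : ℤ) : K8 := ⟨⟨⟨a, b⟩, ⟨c, d⟩⟩, ⟨⟨e, f⟩, ⟨g, h⟩⟩⟩

end K8

/-- Elements of a commutative ring that satisfy the relations of `√5`, `s` and `y`. -/
structure Radicals (A : Type*) [CommRing A] where
  q : A
  s : A
  y : A
  hq : q ^ 2 = 5
  hs : s ^ 2 = 2 * q - 1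
  hy : y ^ 2 = 5 - 3 * q + (1 + q) * s

namespace K8
variable {A : Type*} [CommRing A] (ρ : Radicals A)

/-- The value of `a + b y`. -/
def ev (x : K8) : A := x.a.ev ρ.q ρ.s + x.b.ev ρ.q ρ.s * ρ.y

theorem ev_mk8 (a b c d e f g h : ℤ) : ev ρ (mk8 a b c d e f g h) =
    a + b * ρ.q + (c + d * ρ.q) * ρ.s + (e + f * ρ.q + (g + h * ρ.q) * ρ.s) * ρ.y := rfl

theorem ev_neg (x : K8) : ev ρ (-x) = -ev ρ x := by
  change K4.ev ρ.q ρ.s (-x.a) + K4.ev ρ.q ρ.s (-x.b) * ρ.y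
    = -(x.a.ev ρ.q ρ.s + x.b.ev ρ.q ρ.s * ρ.y)
  simp only [K4.ev_neg]; ring

theorem ev_add (x y : K8) : ev ρ (x + y) = ev ρ x + ev ρ y := by
  change K4.ev ρ.q ρ.s (x.a + y.a) + K4.ev ρ.q ρ.s (x.b + y.b) * ρ.y
    = (x.a.ev ρ.q ρ.s + x.b.ev ρ.q ρ.s * ρ.y) + (y.a.ev ρ.q ρ.s + y.b.ev ρ.q ρ.s * ρ.y)
  simp only [K4.ev_add]; ring

theorem ev_sub (x y : K8) : ev ρ (x - y) = ev ρ x - ev ρ y := by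
  change K4.ev ρ.q ρ.s (x.a - y.a) + K4.ev ρ.q ρ.s (x.b - y.b) * ρ.y
    = (x.a.ev ρ.q ρ.s + x.b.ev ρ.q ρ.s * ρ.y) - (y.a.ev ρ.q ρ.s + y.b.ev ρ.q ρ.s * ρ.y)
  simp only [K4.ev_sub]; ring

theorem ev_mul (x y : K8) : ev ρ (x * y) = ev ρ x * ev ρ y := by
  change K4.ev ρ.q ρ.s (x.a * y.a + ⟨⟨5, -3⟩, ⟨1, 1⟩⟩ * (x.b * y.b)) +
      K4.ev ρ.q ρ.s (x.a * y.b + x.b * y.a) * ρ.y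
    = (x.a.ev ρ.q ρ.s + x.b.ev ρ.q ρ.s * ρ.y) * (y.a.ev ρ.q ρ.s + y.b.ev ρ.q ρ.s * ρ.y)
  simp only [K4.ev_add, K4.ev_mul ρ.hq ρ.hs]
  have : K4.ev ρ.q ρ.s ⟨⟨5, -3⟩, ⟨1, 1⟩⟩ = 5 - 3 * ρ.q + (1 + ρ.q) * ρ.s := by
    simp [K4.ev, Z5.ev]; ring
  rw [this]
  linear_combination (-(x.b.ev ρ.q ρ.s * y.b.ev ρ.q ρ.s)) * ρ.hy
end K8

/-- The real numbers `√5`, `s`, `y = 2 z`. -/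
noncomputable def realRadicals : Radicals ℝ where
  q := √5
  s := sG
  y := 2 * zG
  hq := Real.sq_sqrt (by norm_num)
  hs := sq_sG
  hy := by linear_combination 4 * sq_zG

/-- The same norm argument with the conjugation `s ↦ -s`: the radicand of `y` becomes `5 - 3√5 - (1
+ √5) s`, which is negative. -/
theorem K8.eq_zero_of_ev {x : K8} (h : x.ev realRadicals = 0) : x = 0 := by
  have hq : (√5 : ℝ) ^ 2 = 5 := realRadicals.hq
  have hs : sG ^ 2 = 2 * √5 - 1 := realRadicals.hs
  have hs' : (-sG) ^ 2 = 2 * √5 - 1 := by rw [neg_sq, hs]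
  have hy : (2 * zG) ^ 2 = 5 - 3 * √5 + (1 + √5) * sG := realRadicals.hy
  have hE (s : ℝ) : K4.ev √5 s ⟨⟨5, -3⟩, ⟨1, 1⟩⟩ = 5 - 3 * √5 + (1 + √5) * s := by
    simp [K4.ev, Z5.ev]; ring
  have h1 : x.a * x.a - x.b * x.b * ⟨⟨5, -3⟩, ⟨1, 1⟩⟩ = 0 := by
    refine K4.eq_zero_of_ev hs ?_
    rw [K4.ev_sub, K4.ev_mul hq hs, K4.ev_mul hq hs, K4.ev_mul hq hs, hE]
    change x.a.ev √5 sG + x.b.ev √5 sG * (2 * zG) = 0 at h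
    linear_combination (x.a.ev √5 sG - x.b.ev √5 sG * (2 * zG)) * h +
      (x.b.ev √5 sG) ^ 2 * hy
  have h2 := congrArg (K4.ev √5 (-sG)) h1
  rw [K4.ev_sub, K4.ev_mul hq hs', K4.ev_mul hq hs', K4.ev_mul hq hs', K4.ev_zero, hE] at h2
  have h5 : 2 < √5 := Real.lt_sqrt_of_sq_lt (by norm_num)
  have hs0 : 0 ≤ sG := Real.sqrt_nonneg _
  have hneg : 5 - 3 * √5 + (1 + √5) * -sG < 0 := by nlinarith
  have hb : x.b.ev √5 (-sG) = 0 := by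
    by_contra hb
    have := mul_neg_of_pos_of_neg (mul_self_pos.2 hb) hneg
    nlinarith [mul_self_nonneg (x.a.ev √5 (-sG))]
  have hb := K4.eq_zero_of_ev hs' hb
  have ha : x.a = 0 := by
    refine K4.eq_zero_of_ev hs ?_
    change x.a.ev √5 sG + x.b.ev √5 sG * (2 * zG) = 0 at h
    rwa [hb, K4.ev_zero, zero_mul, add_zero] at h
  exact K8.ext ha hb

/-- This is what certifies non-edges and distinctness of points, and not only edges. -/
theorem K8.ev_injective : Function.Injective (K8.ev realRadicals) := by
  intro x y h
  have h1 : x - y = 0 := K8.eq_zero_of_ev (by rw [K8.ev_sub, h, sub_self])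
  have e (u v : ℤ) : u - v = 0 → u = v := sub_eq_zero.1
  obtain ⟨⟨⟨a1, a2⟩, ⟨a3, a4⟩⟩, ⟨⟨a5, a6⟩, ⟨a7, a8⟩⟩⟩ := x
  obtain ⟨⟨⟨b1, b2⟩, ⟨b3, b4⟩⟩, ⟨⟨b5, b6⟩, ⟨b7, b8⟩⟩⟩ := y
  replace h1 : K8.mk8 (a1 - b1) (a2 - b2) (a3 - b3) (a4 - b4) (a5 - b5) (a6 - b6) (a7 - b7)
    (a8 - b8) = K8.mk8 0 0 0 0 0 0 0 0 := h1
  simp only [K8.mk8, K8.mk.injEq, K4.mk.injEq, Z5.mk.injEq, sub_eq_zero] at h1 ⊢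
  exact h1

/-! ### Vectors, and the group generated by sign changes and cyclic shifts of coordinates -/

/-- A vector with three coordinates. -/
@[ext] structure V3 (R : Type*) where
  x : R
  y : R
  z : R
deriving DecidableEq

namespace V3
variable {R S : Type*}

/-- The coordinatewise image of a vector. -/
def map (f : R → S) (p : V3 R) : V3 S := ⟨f p.x, f p.y, f p.z⟩

/-- The inner product. -/
def ip [Add R] [Mul R] (p q : V3 R) : R := p.x * q.x + p.y * q.y + p.z * q.z

/-- The squared distance. -/
def d2 [Add R] [Sub R] [Mul R] (p q : V3 R) : R :=
  (p.x - q.x) * (p.x - q.x) + (p.y - q.y) * (p.y - q.y) + (p.z - q.z) * (p.z - q.z)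

/-- Change the sign if the flag is set. -/
def flip [Neg R] (b : Bool) (x : R) : R := match b with
  | true => -x
  | false => x

theorem flip_flip [InvolutiveNeg R] (a b : Bool) (x : R) : flip a (flip b x) = flip (xor a b) x := by
  cases a <;> cases b <;> simp [flip]

end V3

/-- The pyritohedral group: sign changes of the coordinates followed by a cyclic shift. -/
structure Pyr where
  c : Fin 3
  b₁ : Bool
  b₂ : Bool
  b₃ : Bool
deriving DecidableEq

namespace Pyr
variable {R S : Type*}

/-- The action of the pyritohedral group on vectors. -/
def act [Neg R] (t : Pyr) (p : V3 R) : V3 R := match t.c with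
  | 0 => ⟨V3.flip t.b₁ p.x, V3.flip t.b₂ p.y, V3.flip t.b₃ p.z⟩
  | 1 => ⟨V3.flip t.b₃ p.z, V3.flip t.b₁ p.x, V3.flip t.b₂ p.y⟩
  | 2 => ⟨V3.flip t.b₂ p.y, V3.flip t.b₃ p.z, V3.flip t.b₁ p.x⟩

/-- The product of the pyritohedral group. -/
def mul (t u : Pyr) : Pyr := match u.c with
  | 0 => ⟨t.c, xor t.b₁ u.b₁, xor t.b₂ u.b₂, xor t.b₃ u.b₃⟩
  | 1 => ⟨t.c + 1, xor t.b₂ u.b₁, xor t.b₃ u.b₂, xor t.b₁ u.b₃⟩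
  | 2 => ⟨t.c + 2, xor t.b₃ u.b₁, xor t.b₁ u.b₂, xor t.b₂ u.b₃⟩

/-- The inverse in the pyritohedral group. -/
def inv (t : Pyr) : Pyr := mul ⟨0, t.b₁, t.b₂, t.b₃⟩ ⟨-t.c, false, false, false⟩

/-- The identity. -/
def one : Pyr := ⟨0, false, false, false⟩

theorem mul_inv (t : Pyr) : mul t (inv t) = one := by
  obtain ⟨c, b₁, b₂, b₃⟩ := t
  revert c b₁ b₂ b₃
  decide

theorem act_one [Neg R] (p : V3 R) : act one p = p := rfl

theorem act_mul [InvolutiveNeg R] (t u : Pyr) (p : V3 R) : act (mul t u) p = act t (act u p) := by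
  obtain ⟨c, b₁, b₂, b₃⟩ := t
  obtain ⟨d, e₁, e₂, e₃⟩ := u
  fin_cases c <;> fin_cases d <;> ext <;> exact (V3.flip_flip _ _ _).symm

theorem map_act [Neg R] [Neg S] (f : R → S) (hf : ∀ x, f (-x) = -f x) (t : Pyr) (p : V3 R) :
    (act t p).map f = act t (p.map f) := by
  have h (b : Bool) (x : R) : f (V3.flip b x) = V3.flip b (f x) := by
    cases b
    · rfl
    · exact hf x
  obtain ⟨c, b₁, b₂, b₃⟩ := t
  fin_cases c <;> ext <;> exact h _ _

/-- The enumeration of the pyritohedral group by the numbers below 24. -/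
def dec (r : ℕ) : Pyr :=
  ⟨⟨r / 8 % 3, Nat.mod_lt _ (by decide)⟩, r / 4 % 2 == 1, r / 2 % 2 == 1, r % 2 == 1⟩

/-- The number of an element of the pyritohedral group. -/
def enc (t : Pyr) : ℕ := 8 * t.c + 4 * t.b₁.toNat + 2 * t.b₂.toNat + t.b₃.toNat

theorem dec_enc (t : Pyr) : dec (enc t) = t := by
  obtain ⟨c, b₁, b₂, b₃⟩ := t
  revert c b₁ b₂ b₃
  decide

theorem enc_lt (t : Pyr) : enc t < 24 := by
  obtain ⟨c, b₁, b₂, b₃⟩ := t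
  revert c b₁ b₂ b₃
  decide

/-- The number of the coset of `t` modulo the stabilizer of a vector with vanishing first
coordinate. -/
def cosetEnc (t : Pyr) : ℕ := 4 * t.c + 2 * t.b₂.toNat + t.b₃.toNat

/-- A representative of a coset modulo the stabilizer of a vector with vanishing first
coordinate. -/
def cosetDec (n : ℕ) : Pyr := dec (8 * (n / 4) + n % 4)

/-- Only the sign `b₁` is lost, and it acts on a coordinate that vanishes for the vectors concerned.
-/
theorem cosetDec_cosetEnc (t : Pyr) : cosetDec (cosetEnc t) = ⟨t.c, false, t.b₂, t.b₃⟩ := by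
  obtain ⟨c, b₁, b₂, b₃⟩ := t
  revert c b₁ b₂ b₃
  decide

theorem cosetEnc_lt (t : Pyr) : cosetEnc t < 12 := by
  obtain ⟨c, b₁, b₂, b₃⟩ := t
  revert c b₁ b₂ b₃
  decide

end Pyr

/-! ### The 732 points -/

section Points
variable {R S : Type*}

/-- The points with numbers below 12 form the orbit of `w` under the pyritohedral group, the
subsequent blocks of 24 points are the orbits of the entries of `B`. -/
def orbitPoint [Neg R] (w : V3 R) (B : List (V3 R)) (n : ℕ) : V3 R :=
  if n < 12 then (Pyr.cosetDec n).act w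
  else (Pyr.dec ((n - 12) % 24)).act (B.getD ((n - 12) / 24) w)

/-- The action of the pyritohedral group on the numbers of points. -/
def actIdx (t : Pyr) (n : ℕ) : ℕ :=
  if n < 12 then (t.mul (Pyr.cosetDec n)).cosetEnc
  else 12 + (24 * ((n - 12) / 24) + (t.mul (Pyr.dec ((n - 12) % 24))).enc)

/-- The number of the base point of the orbit of a point. -/
def baseIdx (n : ℕ) : ℕ := if n < 12 then 0 else 12 + 24 * ((n - 12) / 24)

/-- An element of the pyritohedral group that carries the base point to the given point. -/
def eltIdx (n : ℕ) : Pyr := if n < 12 then Pyr.cosetDec n else Pyr.dec ((n - 12) % 24)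

theorem map_orbitPoint [Neg R] [Neg S] (f : R → S) (hf : ∀ x, f (-x) = -f x) (w : V3 R)
    (B : List (V3 R)) (n : ℕ) :
    (orbitPoint w B n).map f = orbitPoint (w.map f) (B.map (V3.map f)) n := by
  unfold orbitPoint
  split_ifs
  · exact Pyr.map_act f hf _ _
  · rw [Pyr.map_act f hf, List.getD_map]

/-- The hypothesis on `w` expresses that its first coordinate is insensitive to sign, so a coset
representative acts on `w` like every element of its coset. -/
theorem orbitPoint_actIdx [InvolutiveNeg R] {w : V3 R} (hw : -w.x = w.x) (B : List (V3 R))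
    (t : Pyr) (n : ℕ) : orbitPoint w B (actIdx t n) = t.act (orbitPoint w B n) := by
  unfold orbitPoint actIdx
  by_cases h : n < 12
  · have key (u : Pyr) : (⟨u.c, false, u.b₂, u.b₃⟩ : Pyr).act w = u.act w := by
      obtain ⟨c, b₁, b₂, b₃⟩ := u
      cases b₁
      · rfl
      · fin_cases c <;> ext <;> first | exact hw.symm | rfl
    simp only [h, if_true, Pyr.cosetEnc_lt, Pyr.cosetDec_cosetEnc, key, Pyr.act_mul]
  · have h1 := (t.mul (Pyr.dec ((n - 12) % 24))).enc_lt
    rw [if_neg h, if_neg h, if_neg (by omega), Nat.add_sub_cancel_left, Nat.mul_add_mod,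
      Nat.mod_eq_of_lt h1, Nat.mul_add_div (by norm_num), Nat.div_eq_of_lt h1, add_zero,
      Pyr.dec_enc, Pyr.act_mul]

theorem actIdx_lt (t : Pyr) {k n : ℕ} (hn : n < 12 + 24 * k) : actIdx t n < 12 + 24 * k := by
  unfold actIdx
  split_ifs with h
  · exact (Pyr.cosetEnc_lt _).trans_le (Nat.le_add_right _ _)
  · have := (t.mul (Pyr.dec ((n - 12) % 24))).enc_lt
    omega

/-- With this, every question about a point is transported to the base point of its orbit. -/
theorem actIdx_eltIdx (n : ℕ) : actIdx (eltIdx n) (baseIdx n) = n := by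
  have h24 : ∀ r < 24, ((Pyr.dec r).mul (Pyr.dec 0)).enc = r := by decide
  unfold actIdx eltIdx baseIdx
  by_cases h : n < 12
  · simp only [h, if_true, show 0 < 12 by norm_num]
    revert n; decide
  · have : (12 + 24 * ((n - 12) / 24) - 12) % 24 = 0 := by omega
    rw [if_neg h, if_neg h, if_neg (by omega), this, h24 _ (Nat.mod_lt _ (by norm_num))]
    omega

end Points

open K8 (mk8)

/-- The vertex `(0, φ/2, 1/2)` of the icosahedron, magnified by 32. -/
def icoBase : V3 K8 :=
  ⟨mk8 0 0 0 0 0 0 0 0, mk8 8 8 0 0 0 0 0 0, mk8 16 0 0 0 0 0 0 0⟩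

/-- Coordinates are magnified by 32. The orbits are sorted by degree in the product: five of degree
12, ten of degree 11, five of degree 7, ten of degree 6. Entries 0, 5 and 10 are the vertices 6, 7
and 8 of `H91`. -/
def basePoints : List (V3 K8) :=
  [⟨mk8 8 0 8 0 0 0 0 0, mk8 (-4) (-4) 4 4 0 0 0 0, mk8 0 0 0 0 8 0 0 0⟩,
   ⟨mk8 0 (-4) 4 0 (-2) (-2) 0 0, mk8 (-2) (-2) 10 2 (-2) 2 0 0, mk8 6 2 (-2) 2 (-4) 0 0 0⟩,
   ⟨mk8 (-10) (-2) 2 2 2 (-2) 0 0, mk8 (-2) 2 6 2 (-4) 0 0 0, mk8 (-4) 0 0 4 2 2 0 0⟩,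
   ⟨mk8 (-10) (-2) 2 2 (-2) 2 0 0, mk8 (-2) 2 6 2 4 0 0 0, mk8 (-4) 0 0 4 (-2) (-2) 0 0⟩,
   ⟨mk8 0 (-4) 4 0 2 2 0 0, mk8 (-2) (-2) 10 2 2 (-2) 0 0, mk8 6 2 (-2) 2 4 0 0 0⟩,
   ⟨mk8 2 6 (-6) (-2) 0 2 (-2) 0, mk8 4 0 4 0 (-3) 1 (-1) (-1), mk8 6 6 (-2) (-2) (-1) 1 3 1⟩,
   ⟨mk8 (-14) (-2) 6 2 (-5) 1 (-3) (-1), mk8 8 4 (-4) 0 2 0 (-2) 0, mk8 6 (-2) (-2) (-2) 1 1 (-1) (-1)⟩,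
   ⟨mk8 (-6) (-2) 6 2 (-1) (-1) (-1) (-1), mk8 4 0 (-4) 0 5 (-1) (-3) (-1), mk8 18 2 (-2) (-2) 2 0 2 0⟩,
   ⟨mk8 6 (-2) 2 2 2 (-2) 0 0, mk8 10 6 (-6) (-2) 4 0 0 0, mk8 0 (-4) 4 0 0 0 (-2) (-2)⟩,
   ⟨mk8 4 4 0 0 (-3) 1 1 1, mk8 (-4) 4 0 0 (-1) 1 (-3) (-1), mk8 12 4 (-4) (-4) 0 2 2 0⟩,
   ⟨mk8 2 6 (-6) (-2) 0 (-2) 2 0, mk8 4 0 4 0 3 (-1) 1 1, mk8 (-6) (-6) 2 2 (-1) 1 3 1⟩,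
   ⟨mk8 4 4 0 0 3 (-1) (-1) (-1), mk8 (-4) 4 0 0 1 (-1) 3 1, mk8 12 4 (-4) (-4) 0 (-2) (-2) 0⟩,
   ⟨mk8 6 (-2) 2 2 (-2) 2 0 0, mk8 10 6 (-6) (-2) (-4) 0 0 0, mk8 0 (-4) 4 0 0 0 2 2⟩,
   ⟨mk8 (-6) (-2) 6 2 1 1 1 1, mk8 4 0 (-4) 0 (-5) 1 3 1, mk8 18 2 (-2) (-2) (-2) 0 (-2) 0⟩,
   ⟨mk8 (-14) (-2) 6 2 5 (-1) 3 1, mk8 8 4 (-4) 0 (-2) 0 2 0, mk8 6 (-2) (-2) (-2) (-1) (-1) 1 1⟩,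
   ⟨mk8 (-10) 10 (-6) (-2) (-3) (-1) 3 1, mk8 0 4 4 0 2 0 (-2) 0, mk8 (-10) (-2) 6 6 (-1) (-1) 1 1⟩,
   ⟨mk8 (-10) 10 (-6) (-2) 3 1 (-3) (-1), mk8 0 4 4 0 (-2) 0 2 0, mk8 10 2 (-6) (-6) (-1) (-1) 1 1⟩,
   ⟨mk8 10 (-2) (-2) 2 3 1 (-3) (-1), mk8 20 0 (-8) (-4) (-2) 0 2 0, mk8 10 (-6) 10 2 (-1) (-1) 1 1⟩,
   ⟨mk8 10 (-6) 10 2 1 1 (-1) (-1), mk8 10 (-2) (-2) 2 (-3) (-1) 3 1, mk8 20 0 (-8) (-4) 2 0 (-2) 0⟩,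
   ⟨mk8 (-20) 4 12 4 0 0 0 0, mk8 0 8 (-8) 0 0 0 0 0, mk8 0 0 0 0 (-2) (-2) 2 2⟩,
   ⟨mk8 2 (-10) (-2) 2 (-3) (-1) 3 1, mk8 8 4 (-4) 0 6 0 2 0, mk8 (-6) (-6) 10 2 1 1 (-1) (-1)⟩,
   ⟨mk8 26 2 (-10) (-2) 2 0 2 0, mk8 2 (-2) (-2) 2 1 1 1 1, mk8 (-12) 0 (-4) 0 (-1) (-3) 3 1⟩,
   ⟨mk8 12 8 0 (-4) 2 2 0 0, mk8 (-6) 2 (-2) (-2) (-4) 0 2 2, mk8 (-18) 2 6 2 4 0 0 0⟩,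
   ⟨mk8 0 8 0 0 4 2 (-2) 0, mk8 (-12) (-4) 8 0 (-3) 1 1 1, mk8 0 8 (-4) (-4) 1 (-1) 3 1⟩,
   ⟨mk8 8 (-4) 0 4 5 1 (-1) (-1), mk8 14 (-2) (-2) (-2) (-1) 1 3 1, mk8 (-18) (-6) 6 2 0 (-2) 2 0⟩,
   ⟨mk8 26 2 (-10) (-2) (-2) 0 (-2) 0, mk8 2 (-2) (-2) 2 (-1) (-1) (-1) (-1), mk8 12 0 4 0 (-1) (-3) 3 1⟩,
   ⟨mk8 2 (-10) (-2) 2 3 1 (-3) (-1), mk8 8 4 (-4) 0 (-6) 0 (-2) 0, mk8 6 6 (-10) (-2) 1 1 (-1) (-1)⟩,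
   ⟨mk8 (-12) (-4) 8 0 3 (-1) (-1) (-1), mk8 0 8 (-4) (-4) (-1) 1 (-3) (-1), mk8 0 8 0 0 (-4) (-2) 2 0⟩,
   ⟨mk8 (-18) 2 6 2 (-4) 0 0 0, mk8 12 8 0 (-4) (-2) (-2) 0 0, mk8 (-6) 2 (-2) (-2) 4 0 (-2) (-2)⟩,
   ⟨mk8 8 (-4) 0 4 (-5) (-1) 1 1, mk8 14 (-2) (-2) (-2) 1 (-1) (-3) (-1), mk8 18 6 (-6) (-2) 0 (-2) 2 0⟩]

/-- The images of the exact coordinates under `residueRadicals`, as integers. -/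
def icoResidue : V3 ℤ := ⟨0, 981055173, 16⟩

def baseResidues : List (V3 ℤ) :=
  [⟨652162996, 468526479, 609415512⟩,
   ⟨143937518, 273334865, 94001580⟩,
   ⟨847354594, 746164560, 324588961⟩,
   ⟨621172328, 355579613, 941356174⟩,
   ⟨527170764, 499517131, 703417092⟩,
   ⟨631464621, 614237457, 40644809⟩,
   ⟨858165600, 478818772, 868073356⟩,
   ⟨461591592, 194245804, 756072316⟩,
   ⟨847354610, 234890613, 329664489⟩,
   ⟨284572968, 93055754, 908718165⟩,
   ⟨228901536, 37925539, 528116574⟩,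
   ⟨696482205, 887999403, 154229811⟩,
   ⟨621172344, 625475560, 341443793⟩,
   ⟨659097867, 153591675, 775402155⟩,
   ⟨262523843, 850073880, 682346385⟩,
   ⟨513474488, 130981293, 600453582⟩,
   ⟨327946351, 502236401, 213819906⟩,
   ⟨815418148, 400492703, 803035401⟩,
   ⟨988762372, 945826, 29237595⟩,
   ⟨101743698, 328892177, 814273488⟩,
   ⟨19891112, 459488933, 988762356⟩,
   ⟨103909336, 6934887, 379773925⟩,
   ⟨39698999, 966919337, 355579597⟩,
   ⟨987044234, 955681234, 419472924⟩,
   ⟨40016009, 59590111, 368535822⟩,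
   ⟨123239175, 809429071, 31936478⟩,
   ⟨834363434, 869403719, 196965074⟩,
   ⟨367590012, 624529734, 975066096⟩,
   ⟨746164544, 656466212, 564555086⟩,
   ⟨244873985, 490829187, 228901552⟩]

instance : InvolutiveNeg K8 where
  neg_neg x := by
    obtain ⟨⟨⟨a1, a2⟩, ⟨a3, a4⟩⟩, ⟨⟨a5, a6⟩, ⟨a7, a8⟩⟩⟩ := x
    change K8.mk8 (- -a1) (- -a2) (- -a3) (- -a4) (- -a5) (- -a6) (- -a7) (- -a8) = _
    simp only [neg_neg]
    rfl

/-! ### Residues of the points: a fast filter for adjacency, and distinctness. -/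

/-- The modulus of the residues. -/
abbrev modulus : ℕ := 1000000459

/-- A reduction of the ring of coordinates modulo a prime number. -/
def residueRadicals : Radicals (ZMod modulus) where
  q := 247631953
  s := 581520603
  y := 76176939
  hq := by decide +kernel
  hs := by decide +kernel
  hy := by decide +kernel

/-- The points, magnified by the factor 32. -/
def pointK (n : ℕ) : V3 K8 := orbitPoint icoBase basePoints n

/-- The residues of the points. -/
def pointR (n : ℕ) : V3 ℤ := orbitPoint icoResidue baseResidues n

theorem map_icoBase : icoBase.map (K8.ev residueRadicals) = icoResidue.map (Int.cast) := by
  decide +kernel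

theorem map_basePoints : basePoints.map (V3.map (K8.ev residueRadicals)) =
    baseResidues.map (V3.map Int.cast) := by
  decide +kernel

theorem map_pointK (n : ℕ) :
    (pointK n).map (K8.ev residueRadicals) = (pointR n).map Int.cast := by
  unfold pointK pointR
  rw [map_orbitPoint _ (K8.ev_neg _), map_orbitPoint _ Int.cast_neg, map_icoBase, map_basePoints]

theorem V3.ev_d2 {A : Type*} [CommRing A] (ρ : Radicals A) (p q : V3 K8) :
    (V3.d2 p q).ev ρ = V3.d2 (p.map (K8.ev ρ)) (q.map (K8.ev ρ)) := by
  simp only [V3.d2, K8.ev_add, K8.ev_mul, K8.ev_sub, V3.map]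

theorem V3.ev_ip {A : Type*} [CommRing A] (ρ : Radicals A) (p q : V3 K8) :
    (V3.ip p q).ev ρ = V3.ip (p.map (K8.ev ρ)) (q.map (K8.ev ρ)) := by
  simp only [V3.ip, K8.ev_add, K8.ev_mul, V3.map]

/-- The points are at distance one modulo the prime number. -/
def adjR (p q : V3 ℤ) : Bool := (V3.d2 p q - 1024) % modulus == 0

/-- The points are at distance one. -/
def adjK (p q : V3 K8) : Bool := V3.d2 p q = K8.mk8 1024 0 0 0 0 0 0 0

/-- Evaluation in `ZMod modulus` respects sums and products, so an exact distance one persists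
modulo the prime; the cheap test never discards an edge. -/
theorem adjR_of_adjK {n m : ℕ} (h : adjK (pointK n) (pointK m) = true) :
    adjR (pointR n) (pointR m) = true := by
  have h1 : V3.d2 (pointK n) (pointK m) = K8.mk8 1024 0 0 0 0 0 0 0 := by simpa [adjK] using h
  have h2 := congrArg (K8.ev residueRadicals) h1
  rw [V3.ev_d2, map_pointK, map_pointK, K8.ev_mk8] at h2
  have h3 : ((V3.d2 (pointR n) (pointR m) - 1024 : ℤ) : ZMod modulus) = 0 := by
    simp only [V3.d2, V3.map] at h2 ⊢
    push_cast at h2 ⊢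
    linear_combination h2
  have h4 := (ZMod.intCast_zmod_eq_zero_iff_dvd _ _).1 h3
  simpa [adjR] using Int.emod_eq_zero_of_dvd h4

/-- The adjacency test: the exact computation is carried out only where the residues agree. -/
def adjB (n m : ℕ) : Bool := adjR (pointR n) (pointR m) && adjK (pointK n) (pointK m)

theorem adjB_eq_adjK (n m : ℕ) : adjB n m = adjK (pointK n) (pointK m) := by
  rw [adjB, Bool.eq_iff_iff, Bool.and_eq_true]
  exact ⟨And.right, fun h => ⟨adjR_of_adjK h, h⟩⟩

/-- The numbers in the list are distinct, and are not positions of binary ones of `acc`. -/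
def nodupKeys : List ℕ → ℕ → Bool
  | [], _ => true
  | k :: l, acc => !acc.testBit k && nodupKeys l (acc ||| 1 <<< k)

theorem nodup_of_nodupKeys {l : List ℕ} {acc : ℕ} (h : nodupKeys l acc = true) :
    l.Nodup ∧ ∀ k ∈ l, acc.testBit k = false := by
  induction l generalizing acc with
  | nil => simp
  | cons a l ih =>
    simp only [nodupKeys, Bool.and_eq_true, Bool.not_eq_true'] at h
    obtain ⟨h1, h2⟩ := ih h.2
    have h3 : ∀ k ∈ l, acc.testBit k = false ∧ ¬a = k := fun k hk => by
      simpa [Nat.testBit_or, Nat.one_shiftLeft, Nat.testBit_two_pow] using h2 k hk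
    refine ⟨List.nodup_cons.2 ⟨fun ha => (h3 a ha).2 rfl, h1⟩, fun k hk => ?_⟩
    rcases List.mem_cons.1 hk with rfl | hk
    exacts [h.1, (h3 k hk).1]

/-- A number by which the points are told apart. -/
def pointKey (p : V3 ℤ) : ℕ := ((p.x + 6 * p.y + 4 * p.z) % modulus % 16384).toNat

/-- The form `x + 6y + 4z`, reduced modulo the prime and then to 14 bits, already separates all
points; any separating function of the residues would do. -/
theorem nodup_pointKey : ((List.range 732).map fun n => pointKey (pointR n)).Nodup :=
  (nodup_of_nodupKeys (acc := 0) (by decide +kernel)).1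

theorem pointK_injOn {n m : ℕ} (hn : n < 732) (hm : m < 732) (h : pointK n = pointK m) : n = m := by
  have h1 := map_pointK n
  rw [h, map_pointK m] at h1
  have h2 := congrArg V3.x h1
  have h3 := congrArg V3.y h1
  have h4 := congrArg V3.z h1
  simp only [V3.map] at h2 h3 h4
  have h5 : (((pointR m).x + 6 * (pointR m).y + 4 * (pointR m).z : ℤ) : ZMod modulus) =
      (((pointR n).x + 6 * (pointR n).y + 4 * (pointR n).z : ℤ) : ZMod modulus) := by
    push_cast
    rw [h2, h3, h4]
  have h6 : pointKey (pointR n) = pointKey (pointR m) := by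
    unfold pointKey
    rw [← (ZMod.intCast_eq_intCast_iff' _ _ modulus).1 h5]
  exact List.inj_on_of_nodup_map nodup_pointKey (List.mem_range.2 hn) (List.mem_range.2 hm) h6

/-! ### Neighbour lists. -/

/-- The neighbours of the base points. -/
def baseNbrs : List (List ℕ) :=
  [[1, 4, 5, 8, 10, 22, 23, 56, 58, 72, 73, 96, 97, 128, 130, 132, 136, 157, 161, 196, 198, 212, 213,
    236, 237, 253, 257, 284, 285, 308, 309, 340, 342, 349, 353],
   [9, 44, 52, 60, 85, 118, 128, 132, 252, 471, 591, 711],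
   [5, 20, 28, 64, 76, 106, 113, 156, 276, 426, 546, 666],
   [10, 12, 40, 44, 85, 88, 121, 180, 300, 394, 514, 634],
   [10, 13, 49, 61, 64, 112, 116, 204, 324, 419, 539, 659],
   [5, 21, 29, 41, 82, 88, 100, 228, 348, 463, 583, 703],
   [0, 12, 161, 201, 212, 242, 252, 336, 472, 591, 712],
   [1, 36, 137, 200, 216, 241, 276, 294, 421, 546, 661],
   [4, 60, 143, 165, 226, 244, 271, 300, 389, 514, 629],
   [8, 84, 148, 174, 193, 229, 305, 324, 412, 539, 652],
   [8, 108, 151, 178, 188, 205, 348, 360, 464, 583, 704],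
   [1, 12, 132, 194, 288, 310, 341, 352, 472, 592, 711],
   [8, 36, 156, 168, 270, 301, 332, 370, 421, 541, 666],
   [8, 60, 180, 209, 269, 277, 337, 366, 389, 509, 634],
   [4, 84, 150, 204, 262, 292, 322, 357, 412, 532, 659],
   [1, 108, 228, 246, 256, 289, 312, 344, 464, 584, 703],
   [73, 190, 310, 438, 477, 492, 612],
   [99, 212, 332, 455, 478, 516, 636],
   [42, 157, 277, 384, 461, 540, 660],
   [122, 237, 357, 417, 430, 564, 684],
   [15, 136, 256, 392, 413, 588, 708],
   [73, 193, 310, 372, 619, 717],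
   [99, 219, 332, 396, 643, 695],
   [42, 162, 277, 420, 624, 667],
   [122, 242, 357, 444, 670, 691],
   [15, 135, 256, 468, 653, 715],
   [73, 190, 313, 372, 499, 558],
   [99, 212, 339, 396, 523, 598],
   [42, 157, 282, 420, 547, 581],
   [122, 237, 362, 444, 537, 571],
   [15, 136, 255, 468, 512, 595]]

/-- The only place where all distances from the 31 base points are tested; the other neighbour lists
follow by symmetry. -/
theorem baseNbrs_eq : baseNbrs = (List.range 31).map fun k =>
    (List.range 732).filter (adjB (if k = 0 then 0 else 12 + 24 * (k - 1))) := by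
  decide +kernel

/-- The neighbours of a point. -/
def nbrs (n : ℕ) : List ℕ :=
  (baseNbrs.getD (if n < 12 then 0 else (n - 12) / 24 + 1) []).map (actIdx (eltIdx n))

/-! ### A verified search for colourings with four colours

The search is written with the functions on natural numbers for which the kernel has special
support. -/

section Search

/-- Continue with `x` if `n` vanishes, and with `k n` otherwise; the case distinction forces the
evaluation of `n`. -/
def ifZero (n : ℕ) (x : ℕ) (k : ℕ → ℕ) : ℕ := Nat.rec x (fun m _ => k (Nat.succ m)) n

/-- Continue with the value of `n`, after its evaluation. -/
def force (n : ℕ) (k : ℕ → ℕ) : ℕ := ifZero n (k 0) k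

/-- Continue with the predecessor of a positive number, and pass on zero. -/
def andThen (n : ℕ) (k : ℕ → ℕ) : ℕ := Nat.rec 0 (fun m _ => k m) n

/-- Set the binary digits of `a` in the positions given by `m` to zero. -/
def clear (a m : ℕ) : ℕ := Nat.xor a (Nat.land a m)

/-- The binary digit of `a` in the position `v`. -/
def bit (a v : ℕ) : ℕ := Nat.land 1 (Nat.shiftRight a v)

theorem ifZero_zero (x : ℕ) (k : ℕ → ℕ) : ifZero 0 x k = x := rfl

theorem ifZero_of_ne {n : ℕ} (h : n ≠ 0) (x : ℕ) (k : ℕ → ℕ) : ifZero n x k = k n := by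
  cases n
  · exact absurd rfl h
  · rfl

theorem force_eq (n : ℕ) (k : ℕ → ℕ) : force n k = k n := by
  cases n <;> rfl

theorem andThen_ne_zero {n : ℕ} {k : ℕ → ℕ} (h : andThen n k ≠ 0) :
    n ≠ 0 ∧ ∃ m, k m ≠ 0 := by
  cases n with
  | zero => exact absurd rfl h
  | succ m => exact ⟨m.succ_ne_zero, m, h⟩

theorem testBit_clear (a m i : ℕ) : (clear a m).testBit i = (a.testBit i && !m.testBit i) := by
  change (a ^^^ (a &&& m)).testBit i = _
  rw [Nat.testBit_xor, Nat.testBit_and]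
  cases a.testBit i <;> cases m.testBit i <;> rfl

theorem bit_ne_zero {a v : ℕ} : bit a v ≠ 0 ↔ a.testBit v = true := by
  change 1 &&& (a >>> v) ≠ 0 ↔ (1 &&& (a >>> v) != 0) = true
  simp

/-- The position of the highest binary one of a number below `2 ^ 512`. -/
def topBit (s : ℕ) : ℕ := go 9 s 0
where
  /-- The position of the highest binary one of a number below `2 ^ 2 ^ k`, plus `v`. -/
  go : ℕ → ℕ → ℕ → ℕ
  | 0 => fun _ v => v
  | k + 1 => fun s v => ifZero (Nat.shiftRight s (Nat.pow 2 k)) (go k s v) fun r =>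
      go k r (Nat.add v (Nat.pow 2 k))

variable (n full : ℕ) (nb : ℕ → ℕ)

/-- Search for a colouring of the vertices below `n` with four colours, where the vertices that may
still get the four colours are the binary ones of `a`, `b`, `c`, `d`. The binary ones of `nb v` are
the neighbours of `v`. A vertex of `t` for which only one colour is left is removed from `t` and
transmitted to its neighbours; if there is no such vertex, the search branches at a vertex read off
from `cert`. The value is zero if the search fails, and otherwise the successor of the unread part of
`cert`. -/
def refute : ℕ → ℕ → ℕ → ℕ → ℕ → ℕ → ℕ → ℕ
  | 0 => fun _ _ _ _ _ _ => 0
  | fuel + 1 => fun cert a b c d t =>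
    -- Nonzero exactly when some vertex has no colour left; the branch is then closed and `cert` is
    -- passed on whole.
    ifZero (clear full (Nat.lor (Nat.lor a b) (Nat.lor c d)))
      -- The three conjunctions mark the vertices with at least two colours left; what survives the
      -- clearing has exactly one.
      (ifZero (Nat.land t (clear full (Nat.lor (Nat.lor (Nat.land a b) (Nat.land c d))
          (Nat.land (Nat.lor a b) (Nat.lor c d)))))
        -- The branching vertices are the digits of `cert` in base 512, which exceeds the number 372
        -- of vertices.
        (force (Nat.mod cert 512) fun v => force (Nat.div cert 512) fun r =>
          force (Nat.shiftLeft 1 v) fun e =>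
          ifZero (Nat.sub n v) 0 fun _ =>
            force (clear a e) fun a' => force (clear b e) fun b' =>
            force (clear c e) fun c' => force (clear d e) fun d' =>
            -- A colour no longer available for `v` counts as refuted, without reading from the
            -- certificate.
            andThen (ifZero (bit a v) (r + 1) fun _ => refute fuel r a b' c' d' t) fun r =>
            andThen (ifZero (bit b v) (r + 1) fun _ => refute fuel r a' b c' d' t) fun r =>
            andThen (ifZero (bit c v) (r + 1) fun _ => refute fuel r a' b' c d' t) fun r =>
            ifZero (bit d v) (r + 1) fun _ => refute fuel r a' b' c' d t)
        fun s =>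
          force (topBit s) fun v =>
          ifZero (Nat.sub n v) 0 fun _ =>
          ifZero (bit s v) 0 fun _ =>
          force (clear t (Nat.shiftLeft 1 v)) fun t' =>
            ifZero (bit a v)
              (ifZero (bit b v)
                (ifZero (bit c v)
                  (force (clear d (nb v)) fun d' => refute fuel cert a b c d' t')
                  fun _ => force (clear c (nb v)) fun c' => refute fuel cert a b c' d t')
                fun _ => force (clear b (nb v)) fun b' => refute fuel cert a b' c d t')
              fun _ => force (clear a (nb v)) fun a' => refute fuel cert a' b c d t')
      fun _ => cert + 1

/-- The colouring `f` uses each colour only where it is still available. -/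
def Compatible (f : ℕ → Fin 4) (a b c d : ℕ) : Prop :=
  ∀ v < n, (f v = 0 → a.testBit v) ∧ (f v = 1 → b.testBit v) ∧ (f v = 2 → c.testBit v) ∧
    (f v = 3 → d.testBit v)

variable {n full nb}

theorem Compatible.color {f : ℕ → Fin 4} {a b c d : ℕ} (h : Compatible n f a b c d) {v : ℕ}
    (hv : v < n) : f v = 0 ∧ a.testBit v ∨ f v = 1 ∧ b.testBit v ∨ f v = 2 ∧ c.testBit v ∨
      f v = 3 ∧ d.testBit v := by
  obtain ⟨h0, h1, h2, h3⟩ := h v hv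
  have : f v = 0 ∨ f v = 1 ∨ f v = 2 ∨ f v = 3 := by
    generalize f v = k
    revert k; decide
  tauto

theorem testBit_clear_bit {f : ℕ → Fin 4} {v w x : ℕ} {k : Fin 4} (hk : f v ≠ k)
    (hx : f w = k → x.testBit w) : f w = k → (clear x (Nat.shiftLeft 1 v)).testBit w := by
  intro hw
  change (clear x (1 <<< v)).testBit w = true
  rw [testBit_clear, hx hw, Nat.one_shiftLeft, Nat.testBit_two_pow]
  have : v ≠ w := by rintro rfl; exact hk hw
  simp [this]

theorem testBit_clear_nb {f : ℕ → Fin 4}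
    (hf : ∀ v < n, ∀ w < n, (nb v).testBit w = true → f v ≠ f w) {v w x : ℕ} {k : Fin 4}
    (hv : v < n) (hw : w < n) (hk : f v = k) (hx : f w = k → x.testBit w) :
    f w = k → (clear x (nb v)).testBit w := by
  intro hwk
  rw [testBit_clear, hx hwk, Bool.true_and, Bool.not_eq_true']
  by_contra hn
  exact hf v hv w hw (by simpa using hn) (hk.trans hwk.symm)

/-- Soundness is independent of how vertices are chosen: a branching vertex is only required to be
below `n`, and a vertex to be propagated is tested to have a single colour left. A wrong certificate
or wrong `topBit` could only make the search fail. -/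
theorem not_compatible_of_refute {f : ℕ → Fin 4} (hfull : ∀ v, full.testBit v = true → v < n)
    (hf : ∀ v < n, ∀ w < n, (nb v).testBit w = true → f v ≠ f w) {fuel cert a b c d t : ℕ}
    (h : refute n full nb fuel cert a b c d t ≠ 0) : ¬Compatible n f a b c d := by
  induction fuel generalizing cert a b c d t with
  | zero => exact absurd rfl h
  | succ fuel ih =>
    intro hc
    -- A compatible colouring leaves every vertex an available colour, so the closing case cannot
    -- occur.
    have hcover : clear full (Nat.lor (Nat.lor a b) (Nat.lor c d)) = 0 := by
      refine Nat.eq_of_testBit_eq fun v => ?_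
      rw [testBit_clear, Nat.zero_testBit]
      change (full.testBit v && !((a ||| b) ||| (c ||| d)).testBit v) = false
      by_cases hv : full.testBit v = true
      · simp only [Nat.testBit_or]
        rcases hc.color (hfull v hv) with h | h | h | h <;> simp [h.2]
      · simp [hv]
    rw [refute] at h
    beta_reduce at h
    rw [hcover, ifZero_zero] at h
    by_cases hs : Nat.land t (clear full (Nat.lor (Nat.lor (Nat.land a b) (Nat.land c d))
          (Nat.land (Nat.lor a b) (Nat.lor c d)))) = 0
    · rw [hs, ifZero_zero] at h
      simp only [force_eq] at h
      generalize Nat.mod cert 512 = v at h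
      have hv : Nat.sub n v ≠ 0 := fun h0 => by
        rw [h0, ifZero_zero] at h
        exact h rfl
      rw [ifZero_of_ne hv] at h
      obtain ⟨h0, _, h⟩ := andThen_ne_zero h
      obtain ⟨h1, _, h⟩ := andThen_ne_zero h
      obtain ⟨h2, _, h⟩ := andThen_ne_zero h
      rcases hc.color (Nat.lt_of_sub_ne_zero hv) with ⟨hk, hb⟩ | ⟨hk, hb⟩ | ⟨hk, hb⟩ | ⟨hk, hb⟩
      · rw [ifZero_of_ne (bit_ne_zero.2 hb)] at h0
        refine ih h0 fun w hw => ?_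
        obtain ⟨g0, g1, g2, g3⟩ := hc w hw
        exact ⟨g0, testBit_clear_bit (by simp [hk]) g1, testBit_clear_bit (by simp [hk]) g2,
          testBit_clear_bit (by simp [hk]) g3⟩
      · rw [ifZero_of_ne (bit_ne_zero.2 hb)] at h1
        refine ih h1 fun w hw => ?_
        obtain ⟨g0, g1, g2, g3⟩ := hc w hw
        exact ⟨testBit_clear_bit (by simp [hk]) g0, g1, testBit_clear_bit (by simp [hk]) g2,
          testBit_clear_bit (by simp [hk]) g3⟩
      · rw [ifZero_of_ne (bit_ne_zero.2 hb)] at h2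
        refine ih h2 fun w hw => ?_
        obtain ⟨g0, g1, g2, g3⟩ := hc w hw
        exact ⟨testBit_clear_bit (by simp [hk]) g0, testBit_clear_bit (by simp [hk]) g1, g2,
          testBit_clear_bit (by simp [hk]) g3⟩
      · rw [ifZero_of_ne (bit_ne_zero.2 hb)] at h
        refine ih h fun w hw => ?_
        obtain ⟨g0, g1, g2, g3⟩ := hc w hw
        exact ⟨testBit_clear_bit (by simp [hk]) g0, testBit_clear_bit (by simp [hk]) g1,
          testBit_clear_bit (by simp [hk]) g2, g3⟩
    · rw [ifZero_of_ne hs] at h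
      simp only [force_eq] at h
      generalize topBit _ = v at h
      have hv : Nat.sub n v ≠ 0 := fun h0 => by
        rw [h0, ifZero_zero] at h
        exact h rfl
      rw [ifZero_of_ne hv] at h
      have hvn := Nat.lt_of_sub_ne_zero hv
      have hsv : bit (Nat.land t (clear full (Nat.lor (Nat.lor (Nat.land a b) (Nat.land c d))
          (Nat.land (Nat.lor a b) (Nat.lor c d))))) v ≠ 0 := fun h0 => by
        rw [h0, ifZero_zero] at h
        exact h rfl
      rw [ifZero_of_ne hsv] at h
      rw [bit_ne_zero] at hsv
      change (t &&& clear full ((a &&& b) ||| (c &&& d) ||| ((a ||| b) &&& (c ||| d)))).testBit v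
        = true at hsv
      simp only [Nat.testBit_and, testBit_clear, Nat.testBit_or, Bool.and_eq_true,
        Bool.not_eq_true', Bool.or_eq_false_iff, Bool.and_eq_false_iff] at hsv
      have hz (x : ℕ) (hx : x.testBit v = false) : bit x v = 0 := by
        by_contra h0
        exact Bool.false_ne_true (hx.symm.trans (bit_ne_zero.1 h0))
      rcases hc.color hvn with ⟨hk, hb⟩ | ⟨hk, hb⟩ | ⟨hk, hb⟩ | ⟨hk, hb⟩
      · rw [ifZero_of_ne (bit_ne_zero.2 hb)] at h
        refine ih h fun w hw => ?_
        obtain ⟨g0, g1, g2, g3⟩ := hc w hw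
        exact ⟨testBit_clear_nb hf hvn hw hk g0, g1, g2, g3⟩
      · have ha : a.testBit v = false := by simp_all
        rw [hz a ha, ifZero_zero, ifZero_of_ne (bit_ne_zero.2 hb)] at h
        refine ih h fun w hw => ?_
        obtain ⟨g0, g1, g2, g3⟩ := hc w hw
        exact ⟨g0, testBit_clear_nb hf hvn hw hk g1, g2, g3⟩
      · have ha : a.testBit v = false := by simp_all
        have hb' : b.testBit v = false := by simp_all
        rw [hz a ha, ifZero_zero, hz b hb', ifZero_zero, ifZero_of_ne (bit_ne_zero.2 hb)] at h
        refine ih h fun w hw => ?_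
        obtain ⟨g0, g1, g2, g3⟩ := hc w hw
        exact ⟨g0, g1, testBit_clear_nb hf hvn hw hk g2, g3⟩
      · have ha : a.testBit v = false := by simp_all
        have hb' : b.testBit v = false := by simp_all
        have hc' : c.testBit v = false := by simp_all
        rw [hz a ha, ifZero_zero, hz b hb', ifZero_zero, hz c hc', ifZero_zero] at h
        refine ih h fun w hw => ?_
        obtain ⟨g0, g1, g2, g3⟩ := hc w hw
        exact ⟨g0, g1, g2, testBit_clear_nb hf hvn hw hk g3⟩

end Search

/-! ### The points in space -/

section Geometry

/-- The point with the given coordinates, scaled down by the factor 32. -/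
noncomputable def toE (p : V3 K8) : E3 :=
  !₂[p.x.ev realRadicals / 32, p.y.ev realRadicals / 32, p.z.ev realRadicals / 32]

theorem inner_toE (p q : V3 K8) :
    inner ℝ (toE p) (toE q) = (V3.ip p q).ev realRadicals / 1024 := by
  rw [V3.ev_ip]
  simp only [toE, PiLp.inner_apply, Fin.sum_univ_three, V3.ip, V3.map]
  simp
  ring

theorem toE_injective : Function.Injective toE := by
  intro p q h
  have h0 := congrArg (fun v : E3 => v 0) h
  have h1 := congrArg (fun v : E3 => v 1) h
  have h2 := congrArg (fun v : E3 => v 2) h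
  simp only [toE, PiLp.toLp_apply, Matrix.cons_val] at h0 h1 h2
  refine V3.ext (K8.ev_injective ?_) (K8.ev_injective ?_) (K8.ev_injective ?_) <;> linarith

/-- Squared distances are magnified by `32² = 1024`; the equivalence, and not just one implication,
rests on injectivity of evaluation. -/
theorem dist_toE_eq_one {p q : V3 K8} : dist (toE p) (toE q) = 1 ↔ adjK p q = true := by
  rw [adjK, decide_eq_true_iff, ← K8.ev_injective.eq_iff, V3.ev_d2, EuclideanSpace.dist_eq,
    Real.sqrt_eq_one, Fin.sum_univ_three, K8.ev_mk8]
  simp only [toE, PiLp.toLp_apply, Matrix.cons_val, Real.dist_eq, sq_abs, V3.d2, V3.map]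
  constructor <;> intro h
  · push_cast; linear_combination 1024 * h
  · push_cast at h; linear_combination h / 1024

/-- The isometry given by an element of the pyritohedral group. -/
noncomputable def Pyr.iso (t : Pyr) : E3 ≃ₗᵢ[ℝ] E3 :=
  (LinearIsometryEquiv.piLpCongrRight 2 fun i : Fin 3 =>
    if ![t.b₁, t.b₂, t.b₃] i then LinearIsometryEquiv.neg ℝ else LinearIsometryEquiv.refl ℝ ℝ).trans
  (LinearIsometryEquiv.piLpCongrLeft 2 ℝ ℝ (Equiv.addRight t.c))

theorem Pyr.iso_apply (t : Pyr) (x : E3) (i : Fin 3) :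
    t.iso x i = V3.flip (![t.b₁, t.b₂, t.b₃] (i - t.c)) (x (i - t.c)) := by
  have key (b : Bool) (y : ℝ) : (if b then LinearIsometryEquiv.neg ℝ else
      LinearIsometryEquiv.refl ℝ ℝ) y = V3.flip b y := by
    cases b <;> rfl
  rw [sub_eq_add_neg]
  exact key _ _

theorem Pyr.iso_toE (t : Pyr) (p : V3 K8) : t.iso (toE p) = toE (t.act p) := by
  have key (b : Bool) (x : K8) : V3.flip b (x.ev realRadicals / 32) =
      (V3.flip b x).ev realRadicals / 32 := by
    cases b
    · rfl
    · simp [V3.flip, K8.ev_neg, neg_div]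
  obtain ⟨c, b₁, b₂, b₃⟩ := t
  ext i
  rw [Pyr.iso_apply]
  fin_cases c <;> fin_cases i
  exacts [key b₁ p.x, key b₂ p.y, key b₃ p.z, key b₃ p.z, key b₁ p.x, key b₂ p.y, key b₂ p.y,
    key b₃ p.z, key b₁ p.x]

/-- The points. -/
noncomputable def pt (n : ℕ) : E3 := toE (pointK n)

theorem pt_injOn {n m : ℕ} (hn : n < 732) (hm : m < 732) (h : pt n = pt m) : n = m :=
  pointK_injOn hn hm (toE_injective h)

theorem pt_actIdx (t : Pyr) (n : ℕ) : pt (actIdx t n) = t.iso (pt n) := by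
  rw [pt, pt, Pyr.iso_toE, pointK, pointK, orbitPoint_actIdx (by decide)]

theorem actIdx_inv {t : Pyr} {n : ℕ} (hn : n < 732) : actIdx t (actIdx t.inv n) = n := by
  have h1 : actIdx t.inv n < 732 := actIdx_lt (k := 30) _ hn
  refine pointK_injOn (actIdx_lt (k := 30) _ h1) hn ?_
  unfold pointK
  rw [orbitPoint_actIdx (by decide), orbitPoint_actIdx (by decide), ← Pyr.act_mul, Pyr.mul_inv,
    Pyr.act_one]

theorem baseIdx_eq {n : ℕ} (hn : n < 732) : ∃ k < 31, (if n < 12 then 0 else (n - 12) / 24 + 1) = k ∧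
    baseIdx n = if k = 0 then 0 else 12 + 24 * (k - 1) := by
  unfold baseIdx
  split_ifs with h
  · exact ⟨0, by norm_num, rfl, rfl⟩
  · exact ⟨_, by omega, rfl, by simp⟩

theorem nbrs_eq {n : ℕ} (hn : n < 732) :
    nbrs n = ((List.range 732).filter (adjB (baseIdx n))).map (actIdx (eltIdx n)) := by
  obtain ⟨k, hk, h1, h2⟩ := baseIdx_eq hn
  rw [nbrs, h1, baseNbrs_eq, List.getD_eq_getElem _ _ (by simpa using hk), List.getElem_map,
    List.getElem_range, h2]

/-- The isometry of `eltIdx n` carries the base point to `pt n` and permutes the 732 points. -/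
theorem mem_nbrs {n m : ℕ} (hn : n < 732) :
    m ∈ nbrs n ↔ m < 732 ∧ dist (pt n) (pt m) = 1 := by
  have h4 (j : ℕ) : dist (pt n) (pt (actIdx (eltIdx n) j)) = dist (pt (baseIdx n)) (pt j) := by
    rw [pt_actIdx, ← LinearIsometryEquiv.dist_map (eltIdx n).iso (pt (baseIdx n)),
      ← pt_actIdx _ (baseIdx n), actIdx_eltIdx]
  simp only [nbrs_eq hn, List.mem_map, List.mem_filter, List.mem_range, adjB_eq_adjK, ← dist_toE_eq_one]
  constructor
  · rintro ⟨j, ⟨hj, hd⟩, rfl⟩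
    exact ⟨actIdx_lt (k := 30) _ hj, (h4 j).trans hd⟩
  · rintro ⟨hm, hd⟩
    refine ⟨actIdx (eltIdx n).inv m, ⟨actIdx_lt (k := 30) _ hm, ?_⟩, actIdx_inv hm⟩
    rw [← actIdx_inv (t := eltIdx n) hm, h4] at hd
    exact hd

end Geometry

/-! ### Isometries with prescribed values -/

section Isometries

variable {E : Type*} [NormedAddCommGroup E] [InnerProductSpace ℝ E]

/-- Two families of vectors with the same inner products are congruent. -/
theorem exists_isometry_of_inner_eq {n : ℕ} {x y : ℕ → E}
    (h : ∀ i < n, ∀ j < n, inner ℝ (x i) (x j) = inner ℝ (y i) (y j)) :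
    ∃ f : E ≃ₗᵢ[ℝ] E, ∀ i < n, f (x i) = y i := by
  induction n with
  | zero => exact ⟨LinearIsometryEquiv.refl ℝ E, fun i hi => absurd hi (Nat.not_lt_zero i)⟩
  | succ n ih =>
    obtain ⟨f, hf⟩ := ih fun i hi j hj => h i (hi.trans n.lt_succ_self) j (hj.trans n.lt_succ_self)
    have hn : ‖f (x n)‖ = ‖y n‖ := by
      rw [f.norm_map, ← sq_eq_sq₀ (norm_nonneg _) (norm_nonneg _), ← real_inner_self_eq_norm_sq,
        ← real_inner_self_eq_norm_sq]
      exact h n n.lt_succ_self n n.lt_succ_self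
    -- The reflection exchanging `f (x n)` and `y n` fixes every earlier `y i`, since the inner
    -- products make `y i` orthogonal to their difference.
    refine ⟨f.trans (ℝ ∙ (f (x n) - y n))ᗮ.reflection, fun i hi => ?_⟩
    rcases Nat.lt_succ_iff_lt_or_eq.1 hi with hi' | rfl
    · rw [LinearIsometryEquiv.trans_apply, hf i hi']
      refine Submodule.reflection_mem_subspace_eq_self ?_
      rw [Submodule.mem_orthogonal_singleton_iff_inner_right, inner_sub_left,
        ← h n n.lt_succ_self i hi, ← hf i hi', f.inner_map_map, sub_self]
    · exact Submodule.reflection_sub hn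

/-- In three-dimensional space there are at most two vectors of given length that have given inner
products with two independent vectors. -/
theorem eq_or_eq_of_inner_eq (hE : Module.finrank ℝ E = 3) {a b y₁ y₂ y : E}
    (hab : LinearIndependent ℝ ![a, b]) (hne : y₁ ≠ y₂) (hn₁ : ‖y₁‖ = ‖y‖) (hn₂ : ‖y₂‖ = ‖y‖)
    (ha₁ : inner ℝ y₁ a = inner ℝ y a) (ha₂ : inner ℝ y₂ a = inner ℝ y a)
    (hb₁ : inner ℝ y₁ b = inner ℝ y b) (hb₂ : inner ℝ y₂ b = inner ℝ y b) : y = y₁ ∨ y = y₂ := by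
  have : FiniteDimensional ℝ E := FiniteDimensional.of_finrank_pos (by omega)
  set W : Submodule ℝ E := Submodule.span ℝ (Set.range ![a, b]) with hW
  have hW2 : Module.finrank ℝ W = 2 := by
    rw [hW, finrank_span_eq_card hab, Fintype.card_fin]
  have hW1 : Module.finrank ℝ Wᗮ = 1 := by
    have := W.finrank_add_finrank_orthogonal
    omega
  have hmem (v : E) (hva : inner ℝ v a = 0) (hvb : inner ℝ v b = 0) : v ∈ Wᗮ := by
    rw [Submodule.mem_orthogonal']
    intro u hu
    rw [hW, Matrix.range_cons_cons_empty, Submodule.mem_span_pair] at hu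
    obtain ⟨s, t, rfl⟩ := hu
    rw [inner_add_right, inner_smul_right, inner_smul_right, hva, hvb]
    simp
  have hm : y₁ - y₂ ∈ Wᗮ := hmem _ (by rw [inner_sub_left, ha₁, ha₂, sub_self])
    (by rw [inner_sub_left, hb₁, hb₂, sub_self])
  have hd : y - y₁ ∈ Wᗮ := hmem _ (by rw [inner_sub_left, ha₁, sub_self])
    (by rw [inner_sub_left, hb₁, sub_self])
  -- `y₁ - y₂` spans the line orthogonal to `a` and `b`, and `y - y₁` lies on this line.
  obtain ⟨c, hc⟩ := exists_smul_eq_of_finrank_eq_one hW1 (x := ⟨_, hm⟩)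
    (by simpa [Subtype.ext_iff, sub_eq_zero] using hne) ⟨_, hd⟩
  replace hc : c • (y₁ - y₂) = y - y₁ := congrArg Subtype.val hc
  have hy : y = y₁ + c • (y₁ - y₂) := by rw [hc]; abel
  have e1 := congrArg (· ^ 2) hn₁
  have e2 := congrArg (· ^ 2) hn₂
  have hpos : inner ℝ (y₁ - y₂) (y₁ - y₂) ≠ 0 := by
    rw [Ne, inner_self_eq_zero, sub_eq_zero]
    exact hne
  simp only [← real_inner_self_eq_norm_sq, hy] at e1 e2
  simp only [inner_add_left, inner_add_right, inner_sub_left, inner_sub_right, inner_smul_left,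
    inner_smul_right, real_inner_comm y₁ y₂, RCLike.conj_to_real] at e1 e2 hpos
  -- Eliminating the inner product of `y₁` with `y₁ - y₂` from the two norm equations leaves `c (c +
  -- 1) ‖y₁ - y₂‖² = 0`; the root 0 is `y₁`, the root -1 is `y₂`.
  have : c * (c + 1) = 0 := by
    refine (mul_eq_zero.1 ?_).resolve_right hpos
    linear_combination c * e2 - (c + 1) * e1
  rcases mul_eq_zero.1 this with h | h
  · left; rw [hy, h]; simp
  · right; rw [hy, eq_neg_of_add_eq_zero_left h]; simp

end Isometries

/-! ### The vertices of the distance product -/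

section Product

/-- Unscaled, the common value is `(640 + 128√5) / 1024 = (5 + √5) / 8 = cos² (π/10)`. -/
theorem ip_base : ((List.range 31).all fun k =>
    let n := if k = 0 then 0 else 12 + 24 * (k - 1)
    V3.ip (pointK n) (pointK n) = K8.mk8 640 128 0 0 0 0 0 0) = true := by
  decide +kernel

theorem r₁_sq : r₁ ^ 2 = (5 + √5) / 8 := by
  rw [r₁, Real.cos_sq, show 2 * (Real.pi / 10) = Real.pi / 5 by ring, Real.cos_pi_div_five]
  ring

theorem r₁_nonneg : 0 ≤ r₁ :=
  Real.cos_nonneg_of_neg_pi_div_two_le_of_le (by linarith [Real.pi_pos]) (by linarith [Real.pi_pos])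

theorem norm_pt {n : ℕ} (hn : n < 732) : ‖pt n‖ = r₁ := by
  obtain ⟨k, hk, -, h2⟩ := baseIdx_eq hn
  have h3 := List.all_eq_true.1 ip_base k (List.mem_range.2 hk)
  simp only [decide_eq_true_eq, ← h2] at h3
  rw [← actIdx_eltIdx n, pt_actIdx, LinearIsometryEquiv.norm_map,
    ← sq_eq_sq₀ (norm_nonneg _) r₁_nonneg, ← real_inner_self_eq_norm_sq, pt, inner_toE, h3, r₁_sq,
    K8.ev_mk8]
  simp only [realRadicals]
  push_cast
  ring

/-- The numbers of the points that carry the vertices of `L₉,₁`. -/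
def idx91 (k : ℕ) : ℕ := [8, 0, 4, 9, 6, 1, 12, 132, 252].getD k 0

theorem idx91_lt (k : ℕ) : idx91 k < 732 := by
  by_cases h : k < 9
  · revert k; decide
  · rw [idx91, List.getD_eq_default _ _ (by simpa using h)]
    norm_num

/-- The coordinates of the vertices of `L₉,₁`. -/
theorem pt91_eq (k : Fin 9) : pt91 k = pt (idx91 k) := by
  have key {X Y Z : K8} {x y z : ℝ} (hx : X.ev realRadicals / 32 = x)
      (hy : Y.ev realRadicals / 32 = y) (hz : Z.ev realRadicals / 32 = z) :
      !₂[x, y, z] = toE ⟨X, Y, Z⟩ := by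
    rw [toE, hx, hy, hz]
  have hφ : φ = (1 + √5) / 2 := rfl
  fin_cases k
  · refine (key (X := (K8.mk8 8 8 0 0 0 0 0 0))
      (Y := (K8.mk8 16 0 0 0 0 0 0 0))
      (Z := (K8.mk8 0 0 0 0 0 0 0 0)) ?_ ?_ ?_).trans (congrArg toE (by decide +kernel)) <;>
      simp only [K8.ev_mk8, realRadicals, hφ] <;> push_cast <;> ring
  · refine (key (X := (K8.mk8 0 0 0 0 0 0 0 0))
      (Y := (K8.mk8 8 8 0 0 0 0 0 0))
      (Z := (K8.mk8 16 0 0 0 0 0 0 0)) ?_ ?_ ?_).trans (congrArg toE (by decide +kernel)) <;>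
      simp only [K8.ev_mk8, realRadicals, hφ] <;> push_cast <;> ring
  · refine (key (X := (K8.mk8 16 0 0 0 0 0 0 0))
      (Y := (K8.mk8 0 0 0 0 0 0 0 0))
      (Z := (K8.mk8 8 8 0 0 0 0 0 0)) ?_ ?_ ?_).trans (congrArg toE (by decide +kernel)) <;>
      simp only [K8.ev_mk8, realRadicals, hφ] <;> push_cast <;> ring
  · refine (key (X := (K8.mk8 8 8 0 0 0 0 0 0))
      (Y := (K8.mk8 (-16) 0 0 0 0 0 0 0))
      (Z := (K8.mk8 0 0 0 0 0 0 0 0)) ?_ ?_ ?_).trans (congrArg toE (by decide +kernel)) <;>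
      simp only [K8.ev_mk8, realRadicals, hφ] <;> push_cast <;> ring
  · refine (key (X := (K8.mk8 16 0 0 0 0 0 0 0))
      (Y := (K8.mk8 0 0 0 0 0 0 0 0))
      (Z := (K8.mk8 (-8) (-8) 0 0 0 0 0 0)) ?_ ?_ ?_).trans (congrArg toE (by decide +kernel)) <;>
      simp only [K8.ev_mk8, realRadicals, hφ] <;> push_cast <;> ring
  · refine (key (X := (K8.mk8 0 0 0 0 0 0 0 0))
      (Y := (K8.mk8 8 8 0 0 0 0 0 0))
      (Z := (K8.mk8 (-16) 0 0 0 0 0 0 0)) ?_ ?_ ?_).trans (congrArg toE (by decide +kernel)) <;>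
      simp only [K8.ev_mk8, realRadicals, hφ] <;> push_cast <;> ring
  · refine (key (X := (K8.mk8 8 0 8 0 0 0 0 0))
      (Y := (K8.mk8 (-4) (-4) 4 4 0 0 0 0))
      (Z := (K8.mk8 0 0 0 0 8 0 0 0)) ?_ ?_ ?_).trans (congrArg toE (by decide +kernel)) <;>
      simp only [K8.ev_mk8, realRadicals] <;> push_cast <;> ring
  · refine (key (X := (K8.mk8 2 6 (-6) (-2) 0 2 (-2) 0))
      (Y := (K8.mk8 4 0 4 0 (-3) 1 (-1) (-1)))
      (Z := (K8.mk8 6 6 (-2) (-2) (-1) 1 3 1)) ?_ ?_ ?_).trans (congrArg toE (by decide +kernel)) <;>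
      simp only [K8.ev_mk8, realRadicals] <;> push_cast <;> ring
  · refine (key (X := (K8.mk8 2 6 (-6) (-2) 0 (-2) 2 0))
      (Y := (K8.mk8 4 0 4 0 3 (-1) 1 1))
      (Z := (K8.mk8 (-6) (-6) 2 2 (-1) 1 3 1)) ?_ ?_ ?_).trans (congrArg toE (by decide +kernel)) <;>
      simp only [K8.ev_mk8, realRadicals] <;> push_cast <;> ring

theorem mem_icosahedronVertices {p : E3} : p ∈ icosahedronVertices ↔ ∃ n < 12, p = pt n := by
  have hφ : φ = (1 + √5) / 2 := rfl
  have key (n : ℕ) {X Y Z : K8} {x y z : ℝ} (h : pointK n = ⟨X, Y, Z⟩)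
      (hx : X.ev realRadicals / 32 = x) (hy : Y.ev realRadicals / 32 = y)
      (hz : Z.ev realRadicals / 32 = z) : !₂[x, y, z] = pt n := by
    rw [pt, h, toE, hx, hy, hz]
  have hT (a : ℤ) : (K8.mk8 (8 * a) (8 * a) 0 0 0 0 0 0).ev realRadicals / 32 = a * (φ / 2) := by
    simp only [K8.ev_mk8, realRadicals, hφ]; push_cast; ring
  have hH (a : ℤ) : (K8.mk8 (16 * a) 0 0 0 0 0 0 0).ev realRadicals / 32 = a * (1 / 2) := by
    simp only [K8.ev_mk8, realRadicals]; push_cast; ring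
  have h0 : (K8.mk8 0 0 0 0 0 0 0 0).ev realRadicals / 32 = 0 := by
    simp [K8.ev_mk8]
  have h1 (n : ℕ) (a b : ℤ) (h : pointK n = ⟨K8.mk8 0 0 0 0 0 0 0 0, K8.mk8 (8 * a) (8 * a) 0 0 0 0 0 0,
      K8.mk8 (16 * b) 0 0 0 0 0 0 0⟩) : !₂[(0 : ℝ), a * (φ / 2), b * (1 / 2)] = pt n :=
    key n h h0 (hT a) (hH b)
  have h2 (n : ℕ) (a b : ℤ) (h : pointK n = ⟨K8.mk8 (8 * a) (8 * a) 0 0 0 0 0 0,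
      K8.mk8 (16 * b) 0 0 0 0 0 0 0, K8.mk8 0 0 0 0 0 0 0 0⟩) :
      !₂[a * (φ / 2), b * (1 / 2), 0] = pt n :=
    key n h (hT a) (hH b) h0
  have h3 (n : ℕ) (a b : ℤ) (h : pointK n = ⟨K8.mk8 (16 * a) 0 0 0 0 0 0 0, K8.mk8 0 0 0 0 0 0 0 0,
      K8.mk8 (8 * b) (8 * b) 0 0 0 0 0 0⟩) : !₂[(a : ℝ) * (1 / 2), 0, b * (φ / 2)] = pt n :=
    key n h (hH a) h0 (hT b)
  constructor
  · rintro ⟨a, b, rfl | rfl, rfl | rfl, rfl | rfl | rfl⟩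
    · exact ⟨0, by norm_num, by simpa using h1 0 (1) (1) (by decide +kernel)⟩
    · exact ⟨8, by norm_num, by simpa using h2 8 (1) (1) (by decide +kernel)⟩
    · exact ⟨4, by norm_num, by simpa using h3 4 (1) (1) (by decide +kernel)⟩
    · exact ⟨1, by norm_num, by simpa using h1 1 (1) (-1) (by decide +kernel)⟩
    · exact ⟨9, by norm_num, by simpa using h2 9 (1) (-1) (by decide +kernel)⟩
    · exact ⟨6, by norm_num, by simpa using h3 6 (1) (-1) (by decide +kernel)⟩
    · exact ⟨2, by norm_num, by simpa using h1 2 (-1) (1) (by decide +kernel)⟩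
    · exact ⟨10, by norm_num, by simpa using h2 10 (-1) (1) (by decide +kernel)⟩
    · exact ⟨5, by norm_num, by simpa using h3 5 (-1) (1) (by decide +kernel)⟩
    · exact ⟨3, by norm_num, by simpa using h1 3 (-1) (-1) (by decide +kernel)⟩
    · exact ⟨11, by norm_num, by simpa using h2 11 (-1) (-1) (by decide +kernel)⟩
    · exact ⟨7, by norm_num, by simpa using h3 7 (-1) (-1) (by decide +kernel)⟩
  · rintro ⟨n, hn, rfl⟩
    interval_cases n
    · exact ⟨1, 1, by norm_num, by norm_num, Or.inl (by simpa using (h1 0 (1) (1) (by decide +kernel)).symm)⟩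
    · exact ⟨1, -1, by norm_num, by norm_num, Or.inl (by simpa using (h1 1 (1) (-1) (by decide +kernel)).symm)⟩
    · exact ⟨-1, 1, by norm_num, by norm_num, Or.inl (by simpa using (h1 2 (-1) (1) (by decide +kernel)).symm)⟩
    · exact ⟨-1, -1, by norm_num, by norm_num, Or.inl (by simpa using (h1 3 (-1) (-1) (by decide +kernel)).symm)⟩
    · exact ⟨1, 1, by norm_num, by norm_num, Or.inr <| Or.inr (by simpa using (h3 4 (1) (1) (by decide +kernel)).symm)⟩
    · exact ⟨-1, 1, by norm_num, by norm_num, Or.inr <| Or.inr (by simpa using (h3 5 (-1) (1) (by decide +kernel)).symm)⟩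
    · exact ⟨1, -1, by norm_num, by norm_num, Or.inr <| Or.inr (by simpa using (h3 6 (1) (-1) (by decide +kernel)).symm)⟩
    · exact ⟨-1, -1, by norm_num, by norm_num, Or.inr <| Or.inr (by simpa using (h3 7 (-1) (-1) (by decide +kernel)).symm)⟩
    · exact ⟨1, 1, by norm_num, by norm_num, Or.inr <| Or.inl (by simpa using (h2 8 (1) (1) (by decide +kernel)).symm)⟩
    · exact ⟨1, -1, by norm_num, by norm_num, Or.inr <| Or.inl (by simpa using (h2 9 (1) (-1) (by decide +kernel)).symm)⟩
    · exact ⟨-1, 1, by norm_num, by norm_num, Or.inr <| Or.inl (by simpa using (h2 10 (-1) (1) (by decide +kernel)).symm)⟩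
    · exact ⟨-1, -1, by norm_num, by norm_num, Or.inr <| Or.inl (by simpa using (h2 11 (-1) (-1) (by decide +kernel)).symm)⟩

theorem H121_adj {u v : E3} : H121.Adj u v ↔
    ∃ a < 12, ∃ b < 12, u = pt a ∧ v = pt b ∧ dist (pt a) (pt b) = 1 := by
  have : H121.Adj u v ↔ u ∈ icosahedronVertices ∧ v ∈ icosahedronVertices ∧ dist u v = 1 := Iff.rfl
  rw [this, mem_icosahedronVertices, mem_icosahedronVertices]
  constructor
  · rintro ⟨⟨a, ha, rfl⟩, ⟨b, hb, rfl⟩, h⟩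
    exact ⟨a, ha, b, hb, rfl, rfl, h⟩
  · rintro ⟨a, ha, b, hb, rfl, rfl, h⟩
    exact ⟨⟨a, ha, rfl⟩, ⟨b, hb, rfl⟩, h⟩

theorem H91_verts : H91.verts = Set.range pt91 := by
  change pt91 '' Set.univ = _
  exact Set.image_univ

theorem H91_adj {u v : E3} : H91.Adj u v ↔ ∃ i j, L91.Adj i j ∧ pt91 i = u ∧ pt91 j = v := Iff.rfl

/-- The edges of `L₉,₁`, with both orientations. -/
def edges91 : List (ℕ × ℕ) :=
  [(0, 1), (0, 2), (0, 3), (0, 4), (0, 5), (1, 2), (2, 3), (3, 4), (4, 5), (6, 7), (6, 8), (7, 8),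
    (3, 6), (1, 7), (5, 8), (1, 0), (2, 0), (3, 0), (4, 0), (5, 0), (2, 1), (3, 2), (4, 3), (5, 4),
    (7, 6), (8, 6), (8, 7), (6, 3), (7, 1), (8, 5)]

set_option synthInstance.maxSize 1000 in
set_option synthInstance.maxHeartbeats 200000 in
theorem mem_edges91 (i j : Fin 9) : ((i : ℕ), (j : ℕ)) ∈ edges91 ↔ L91.Adj i j := by
  rw [L91, SimpleGraph.fromEdgeSet_adj]
  simp only [Set.mem_insert_iff, Set.mem_singleton_iff, Sym2.eq_iff]
  revert i j
  decide +kernel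

theorem verts_udg (V : Set E3) : (udg V).verts = V := rfl

theorem mem_productGraph_verts {x : E3} : x ∈ productGraph.verts ↔
    ∃ f ∈ gluingIsometries H121 H91, ∃ k, x = f (pt91 k) := by
  rw [productGraph, distanceProduct, verts_udg, H91_verts]
  simp only [Set.mem_iUnion, Set.mem_image, Set.mem_range, exists_exists_eq_and, exists_prop]
  simp only [eq_comm]

theorem mem_gluingIsometries {f : E3 ≃ₗᵢ[ℝ] E3} {i j : Fin 9} (hij : L91.Adj i j) {a b : ℕ}
    (ha : a < 12) (hb : b < 12) (h1 : f (pt91 i) = pt a) (h2 : f (pt91 j) = pt b) :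
    f ∈ gluingIsometries H121 H91 := by
  refine ⟨pt a, pt b, pt91 i, pt91 j, H121_adj.2 ⟨a, ha, b, hb, rfl, rfl, ?_⟩,
    H91_adj.2 ⟨i, j, hij, rfl, rfl⟩, Or.inl ⟨h1, h2⟩⟩
  rw [← h1, ← h2, f.dist_map]
  exact dist_pt91 hij

/-- For each base point, an edge and a vertex of `L₉,₁`, and an edge of the icosahedron, such that
the isometry that glues the edges maps the vertex to the base point. -/
def baseGluings : List (ℕ × ℕ × ℕ × ℕ × ℕ) :=
  [(0, 1, 0, 0, 1), (0, 1, 6, 8, 0), (0, 1, 6, 0, 1), (0, 1, 6, 0, 4), (0, 1, 6, 0, 8), (0, 1, 6,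
   0, 8), (0, 1, 7, 8, 0), (0, 1, 7, 0, 1), (0, 1, 7, 0, 4), (0, 1, 7, 0, 8), (0, 1, 7, 0, 8), (0,
   1, 8, 8, 0), (0, 1, 8, 0, 1), (0, 1, 8, 0, 4), (0, 1, 8, 0, 8), (0, 1, 8, 0, 8), (6, 7, 0, 0,
   1), (6, 7, 0, 1, 8), (6, 7, 0, 4, 8), (6, 7, 0, 8, 4), (6, 7, 0, 8, 1), (6, 7, 2, 0, 1), (6, 7,
   2, 1, 8), (6, 7, 2, 4, 8), (6, 7, 2, 8, 4), (6, 7, 2, 8, 1), (6, 7, 4, 0, 1), (6, 7, 4, 1, 8),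
   (6, 7, 4, 4, 8), (6, 7, 4, 8, 4), (6, 7, 4, 8, 1)]

/-- The three given vertices of `L₉,₁` are congruent to the three given points. -/
def congruentTriples (i j k a b c : ℕ) : Bool :=
  V3.ip (pointK (idx91 i)) (pointK (idx91 j)) = V3.ip (pointK a) (pointK b) &&
  V3.ip (pointK (idx91 k)) (pointK (idx91 i)) = V3.ip (pointK c) (pointK a) &&
  V3.ip (pointK (idx91 k)) (pointK (idx91 j)) = V3.ip (pointK c) (pointK b)

theorem baseGluings_spec : ((List.range 31).all fun m =>
    let e := baseGluings.getD m (0, 0, 0, 0, 0)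
    decide ((e.1, e.2.1) ∈ edges91) && decide (e.1 < 9) && decide (e.2.1 < 9) &&
      decide (e.2.2.1 < 9) && decide (e.2.2.2.1 < 12) && decide (e.2.2.2.2 < 12) &&
      congruentTriples e.1 e.2.1 e.2.2.1 e.2.2.2.1 e.2.2.2.2
        (if m = 0 then 0 else 12 + 24 * (m - 1))) = true := by
  decide +kernel

theorem inner_pt_eq {n m n' m' : ℕ}
    (h : V3.ip (pointK n) (pointK m) = V3.ip (pointK n') (pointK m')) :
    inner ℝ (pt n) (pt m) = inner ℝ (pt n') (pt m') := by
  rw [pt, pt, pt, pt, inner_toE, inner_toE, h]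

theorem inner_pt_self {n : ℕ} (hn : n < 732) : inner ℝ (pt n) (pt n) = r₁ ^ 2 := by
  rw [real_inner_self_eq_norm_sq, norm_pt hn]

/-- A triple from `H91` is congruent to an icosahedron edge together with the base point; equal
inner products give an isometry, which glues the edge and hits the base point. -/
theorem pt_mem_productGraph {n : ℕ} (hn : n < 732) : pt n ∈ productGraph.verts := by
  obtain ⟨m, hm, -, h2⟩ := baseIdx_eq hn
  have h3 := List.all_eq_true.1 baseGluings_spec m (List.mem_range.2 hm)
  simp only [← h2] at h3
  generalize baseGluings.getD m (0, 0, 0, 0, 0) = e at h3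
  obtain ⟨i, j, k, a, b⟩ := e
  simp only [congruentTriples, Bool.and_eq_true, decide_eq_true_eq] at h3
  obtain ⟨⟨⟨⟨⟨⟨hij, hi⟩, hj⟩, hk⟩, ha⟩, hb⟩, ⟨e1, e2⟩, e3⟩ := h3
  have hB : baseIdx n < 732 := by unfold baseIdx; split_ifs <;> omega
  obtain ⟨f, hf⟩ := exists_isometry_of_inner_eq (n := 3)
    (x := fun r => pt (idx91 ([i, j, k].getD r 0))) (y := fun r => pt ([a, b, baseIdx n].getD r 0))
    (by
      have g1 := inner_pt_eq e1
      have g2 := inner_pt_eq e2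
      have g3 := inner_pt_eq e3
      have s1 := inner_pt_self (ha.trans (show 12 < 732 by norm_num))
      have s2 := inner_pt_self (hb.trans (show 12 < 732 by norm_num))
      have s3 := inner_pt_self hB
      have t1 := inner_pt_self (idx91_lt i)
      have t2 := inner_pt_self (idx91_lt j)
      have t3 := inner_pt_self (idx91_lt k)
      intro r hr r' hr'
      interval_cases r <;> interval_cases r' <;> simp only [List.getD_cons_zero, List.getD_cons_succ]
      · rw [s1, t1]
      · exact g1
      · rw [real_inner_comm, g2, real_inner_comm]
      · rw [real_inner_comm, g1, real_inner_comm]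
      · rw [s2, t2]
      · rw [real_inner_comm, g3, real_inner_comm]
      · exact g2
      · exact g3
      · rw [s3, t3])
  have f1 : f (pt (idx91 i)) = pt a := hf 0 (by norm_num)
  have f2 : f (pt (idx91 j)) = pt b := hf 1 (by norm_num)
  have f3 : f (pt (idx91 k)) = pt (baseIdx n) := hf 2 (by norm_num)
  -- A gluing followed by an element of the group is again a gluing, because the numbers below 12
  -- are permuted (`k := 0`).
  refine mem_productGraph_verts.2 ⟨f.trans (eltIdx n).iso, mem_gluingIsometries (i := ⟨i, hi⟩)
    (j := ⟨j, hj⟩) ((mem_edges91 _ _).1 hij) (a := actIdx (eltIdx n) a) (b := actIdx (eltIdx n) b)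
    (actIdx_lt (k := 0) _ ha) (actIdx_lt (k := 0) _ hb) ?_ ?_, ⟨k, hk⟩, ?_⟩
  · rw [pt91_eq, pt_actIdx, LinearIsometryEquiv.trans_apply, f1]
  · rw [pt91_eq, pt_actIdx, LinearIsometryEquiv.trans_apply, f2]
  · rw [pt91_eq, LinearIsometryEquiv.trans_apply, f3, ← pt_actIdx, actIdx_eltIdx]

end Product

/-! ### Every vertex of the product is one of the 732 points. -/

section Product

/-- The pairs of points with given inner products with the points `0` and `v`, for the values of the
inner products that occur when an edge `i j` of `L₉,₁` is glued to these two points and the image of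
the vertex `k` is to be found; `v` runs through `1` and `4`, the edges through `edges91`, and `k`
through the nine vertices. -/
def gluedPairs : List (ℕ × ℕ) :=
  [(0, 0), (1, 1), (8, 10), (4, 5), (4, 5), (8, 10), (36, 40), (156, 160), (276, 280), (0, 0), (8,
   10), (1, 1), (8, 10), (4, 5), (4, 5), (84, 88), (204, 208), (324, 328), (0, 0), (4, 5), (8,
   10), (1, 1), (8, 10), (4, 5), (20, 21), (140, 141), (260, 261), (0, 0), (4, 5), (4, 5), (8,
   10), (1, 1), (8, 10), (60, 64), (180, 184), (300, 304), (0, 0), (8, 10), (4, 5), (4, 5), (8,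
   10), (1, 1), (108, 112), (228, 232), (348, 352), (8, 10), (0, 0), (1, 1), (6, 7), (9, 11), (4,
   5), (76, 78), (196, 198), (316, 318), (8, 10), (4, 5), (0, 0), (1, 1), (6, 7), (9, 11), (124,
   126), (244, 246), (364, 366), (8, 10), (9, 11), (4, 5), (0, 0), (1, 1), (6, 7), (56, 58), (176,
   178), (296, 298), (8, 10), (6, 7), (9, 11), (4, 5), (0, 0), (1, 1), (104, 106), (224, 226),
   (344, 346), (372, 376), (310, 311), (492, 496), (72, 73), (612, 616), (190, 191), (0, 0), (1,
   1), (8, 10), (397, 401), (334, 335), (517, 521), (96, 97), (637, 641), (214, 215), (0, 0), (8,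
   10), (1, 1), (469, 473), (253, 257), (589, 593), (14, 18), (709, 713), (133, 137), (8, 10), (0,
   0), (1, 1), (22, 23), (94, 95), (128, 130), (0, 0), (56, 58), (70, 71), (1, 1), (74, 75), (98,
   99), (157, 161), (0, 0), (196, 198), (218, 219), (242, 243), (132, 136), (310, 311), (1, 1),
   (252, 256), (349, 353), (253, 257), (290, 291), (314, 315), (340, 342), (0, 0), (214, 215),
   (133, 137), (1, 1), (1, 1), (0, 0), (8, 10), (6, 7), (6, 7), (8, 10), (37, 41), (157, 161),
   (277, 281), (1, 1), (8, 10), (0, 0), (8, 10), (6, 7), (6, 7), (85, 89), (205, 209), (325, 329),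
   (1, 1), (6, 7), (8, 10), (0, 0), (8, 10), (6, 7), (22, 23), (142, 143), (262, 263), (1, 1), (6,
   7), (6, 7), (8, 10), (0, 0), (8, 10), (61, 65), (181, 185), (301, 305), (1, 1), (8, 10), (6,
   7), (6, 7), (8, 10), (0, 0), (109, 113), (229, 233), (349, 353), (8, 10), (1, 1), (0, 0), (4,
   5), (9, 11), (6, 7), (80, 82), (200, 202), (320, 322), (8, 10), (6, 7), (1, 1), (0, 0), (4, 5),
   (9, 11), (128, 130), (248, 250), (368, 370), (8, 10), (9, 11), (6, 7), (1, 1), (0, 0), (4, 5),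
   (52, 54), (172, 174), (292, 294), (8, 10), (4, 5), (9, 11), (6, 7), (1, 1), (0, 0), (100, 102),
   (220, 222), (340, 342), (373, 377), (308, 309), (493, 497), (74, 75), (613, 617), (188, 189),
   (1, 1), (0, 0), (8, 10), (396, 400), (332, 333), (516, 520), (98, 99), (636, 640), (212, 213),
   (1, 1), (8, 10), (0, 0), (468, 472), (252, 256), (588, 592), (15, 19), (708, 712), (132, 136),
   (8, 10), (1, 1), (0, 0), (20, 21), (92, 93), (124, 126), (1, 1), (52, 54), (68, 69), (0, 0),
   (72, 73), (96, 97), (156, 160), (1, 1), (200, 202), (216, 217), (240, 241), (133, 137), (308,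
   309), (0, 0), (253, 257), (348, 352), (252, 256), (288, 289), (312, 313), (344, 346), (1, 1),
   (212, 213), (132, 136), (0, 0), (0, 0), (4, 4), (5, 8), (1, 10), (1, 10), (5, 8), (20, 60),
   (140, 180), (260, 300), (0, 0), (5, 8), (4, 4), (5, 8), (1, 10), (1, 10), (64, 108), (184,
   228), (304, 348), (0, 0), (1, 10), (5, 8), (4, 4), (5, 8), (1, 10), (40, 112), (160, 232),
   (280, 352), (0, 0), (1, 10), (1, 10), (5, 8), (4, 4), (5, 8), (36, 88), (156, 208), (276, 328),
   (0, 0), (5, 8), (1, 10), (1, 10), (5, 8), (4, 4), (21, 84), (141, 204), (261, 324), (5, 8), (0,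
   0), (4, 4), (2, 9), (6, 11), (1, 10), (12, 93), (132, 213), (252, 333), (5, 8), (1, 10), (0,
   0), (4, 4), (2, 9), (6, 11), (30, 80), (150, 200), (270, 320), (5, 8), (6, 11), (1, 10), (0,
   0), (4, 4), (2, 9), (73, 128), (193, 248), (313, 368), (5, 8), (2, 9), (6, 11), (1, 10), (0,
   0), (4, 4), (52, 121), (172, 241), (292, 361), (436, 477), (265, 293), (556, 597), (22, 58),
   (676, 717), (145, 173), (0, 0), (4, 4), (5, 8), (452, 476), (264, 365), (572, 596), (23, 130),
   (692, 716), (144, 245), (0, 0), (5, 8), (4, 4), (404, 428), (285, 340), (524, 548), (50, 107),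
   (644, 668), (165, 220), (5, 8), (0, 0), (4, 4), (72, 96), (24, 125), (56, 97), (0, 0), (73,
   128), (25, 53), (4, 4), (105, 114), (42, 81), (212, 236), (0, 0), (132, 213), (162, 201), (135,
   158), (196, 237), (265, 293), (4, 4), (316, 357), (284, 308), (285, 340), (254, 350), (345,
   354), (253, 309), (0, 0), (144, 245), (165, 220), (4, 4), (4, 4), (0, 0), (5, 8), (2, 9), (2,
   9), (5, 8), (92, 116), (212, 236), (332, 356), (4, 4), (5, 8), (0, 0), (5, 8), (2, 9), (2, 9),
   (28, 48), (148, 168), (268, 288), (4, 4), (2, 9), (5, 8), (0, 0), (5, 8), (2, 9), (72, 96),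
   (192, 216), (312, 336), (4, 4), (2, 9), (2, 9), (5, 8), (0, 0), (5, 8), (29, 120), (149, 240),
   (269, 360), (4, 4), (5, 8), (2, 9), (2, 9), (5, 8), (0, 0), (44, 68), (164, 188), (284, 308),
   (5, 8), (4, 4), (0, 0), (1, 10), (6, 11), (2, 9), (49, 124), (169, 244), (289, 364), (5, 8),
   (2, 9), (4, 4), (0, 0), (1, 10), (6, 11), (56, 97), (176, 217), (296, 337), (5, 8), (6, 11),
   (2, 9), (4, 4), (0, 0), (1, 10), (31, 104), (151, 224), (271, 344), (5, 8), (1, 10), (6, 11),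
   (2, 9), (4, 4), (0, 0), (13, 69), (133, 189), (253, 309), (405, 460), (342, 349), (525, 580),
   (105, 114), (645, 700), (222, 229), (4, 4), (0, 0), (5, 8), (380, 420), (277, 318), (500, 540),
   (42, 81), (620, 660), (157, 198), (4, 4), (5, 8), (0, 0), (381, 444), (316, 357), (501, 564),
   (83, 122), (621, 684), (196, 237), (5, 8), (4, 4), (0, 0), (40, 112), (37, 78), (30, 80), (4,
   4), (31, 104), (102, 109), (0, 0), (22, 58), (23, 130), (140, 180), (4, 4), (169, 244), (143,
   250), (185, 226), (165, 220), (342, 349), (0, 0), (285, 340), (261, 324), (316, 357), (322,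
   329), (262, 298), (292, 361), (4, 4), (157, 198), (196, 237), (0, 0)]

/-- The two points are the possible images of the vertex `k` of `L₉,₁` under isometries that map
the vertices `i` and `j` to the points `0` and `v`. -/
def imagesOf (v i j k : ℕ) (y : ℕ × ℕ) : Bool :=
  k == i || k == j || (y.1 != y.2 && decide (y.1 < 732) && decide (y.2 < 732) &&
    V3.ip (pointK y.1) (pointK 0) = V3.ip (pointK (idx91 k)) (pointK (idx91 i)) &&
    V3.ip (pointK y.2) (pointK 0) = V3.ip (pointK (idx91 k)) (pointK (idx91 i)) &&
    V3.ip (pointK y.1) (pointK v) = V3.ip (pointK (idx91 k)) (pointK (idx91 j)) &&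
    V3.ip (pointK y.2) (pointK v) = V3.ip (pointK (idx91 k)) (pointK (idx91 j)))

/-- Every entry of the first list satisfies the condition together with the entry of the second
list at the same position. -/
def allMatched {α β : Type*} (p : α → β → Bool) : List α → List β → Bool
  | [], _ => true
  | _ :: _, [] => false
  | a :: l, b :: l' => p a b && allMatched p l l'

theorem exists_of_allMatched {α β : Type*} {p : α → β → Bool} {l : List α} {l' : List β}
    (h : allMatched p l l' = true) {a : α} (ha : a ∈ l) : ∃ b, p a b = true := by
  induction l generalizing l' with
  | nil => exact absurd ha List.not_mem_nil
  | cons c l ih =>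
    cases l' with
    | nil => exact absurd h Bool.false_ne_true
    | cons b l' =>
      rw [allMatched, Bool.and_eq_true] at h
      rcases List.mem_cons.1 ha with rfl | ha
      exacts [⟨b, h.1⟩, ih h.2 ha]

/-- There are 2 · 30 · 9 = 540 cases. Where `k` is an end of the glued edge its image is known, and
the entry is a filler. -/
theorem gluedPairs_spec : allMatched (fun (e : ℕ × (ℕ × ℕ) × ℕ) y => imagesOf e.1 e.2.1.1 e.2.1.2 e.2.2 y)
    ([1, 4].flatMap fun v => edges91.flatMap fun e => (List.range 9).map fun k => (v, e, k))
    gluedPairs = true := by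
  decide +kernel

/-- The edge `{0, 1}` is parallel to an axis and has an orbit of 6 edges; `{0, 4}` represents the
other 24. -/
theorem nbrs_icosahedron : ((List.range 12).all fun a => (List.range 12).all fun b =>
    !(nbrs a).contains b || (List.range 24).any fun r => [1, 4].any fun v =>
      (actIdx (Pyr.dec r) 0 == a && actIdx (Pyr.dec r) v == b) ||
      (actIdx (Pyr.dec r) 0 == b && actIdx (Pyr.dec r) v == a)) = true := by
  decide +kernel

/-- Up to the pyritohedral group, there are two edges of the icosahedron. -/
theorem exists_edge_eq {a b : ℕ} (ha : a < 12) (hb : b < 12) (hab : dist (pt a) (pt b) = 1) :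
    ∃ t : Pyr, ∃ v ∈ [1, 4], (pt a = t.iso (pt 0) ∧ pt b = t.iso (pt v)) ∨
      (pt b = t.iso (pt 0) ∧ pt a = t.iso (pt v)) := by
  have h1 := List.all_eq_true.1 (List.all_eq_true.1 nbrs_icosahedron a (List.mem_range.2 ha)) b
    (List.mem_range.2 hb)
  have h2 : (nbrs a).contains b = true :=
    List.contains_iff_mem.2 ((mem_nbrs (by omega)).2 ⟨by omega, hab⟩)
  rw [h2, Bool.not_true, Bool.false_or, List.any_eq_true] at h1
  obtain ⟨r, -, h1⟩ := h1
  rw [List.any_eq_true] at h1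
  obtain ⟨v, hv, h1⟩ := h1
  simp only [Bool.or_eq_true, Bool.and_eq_true, beq_iff_eq] at h1
  refine ⟨Pyr.dec r, v, hv, ?_⟩
  rw [← pt_actIdx, ← pt_actIdx]
  rcases h1 with ⟨h, h'⟩ | ⟨h, h'⟩
  · exact Or.inl ⟨by rw [h], by rw [h']⟩
  · exact Or.inr ⟨by rw [h], by rw [h']⟩

theorem linearIndependent_pt {v : ℕ} (hv : v ∈ [1, 4]) : LinearIndependent ℝ ![pt 0, pt v] := by
  have key : ∀ v ∈ [1, 4], V3.ip (pointK 0) (pointK v) = K8.mk8 128 128 0 0 0 0 0 0 := by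
    decide +kernel
  have hv' : v < 732 := by
    simp only [List.mem_cons, List.not_mem_nil, or_false] at hv
    omega
  have h0 := inner_pt_self (n := 0) (by norm_num)
  have h1 := inner_pt_self hv'
  have h2 : inner ℝ (pt 0) (pt v) = (1 + √5) / 8 := by
    rw [pt, pt, inner_toE, key v hv, K8.ev_mk8]
    simp only [realRadicals]
    push_cast
    ring
  have h5 : (0 : ℝ) < √5 := by positivity
  rw [LinearIndependent.pair_iff]
  intro s t hst
  have e1 := congrArg (inner ℝ (pt 0)) hst
  have e2 := congrArg (inner ℝ (pt v)) hst
  rw [inner_add_right, inner_smul_right, inner_smul_right, inner_zero_right, h0, h2, r₁_sq] at e1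
  rw [inner_add_right, inner_smul_right, inner_smul_right, inner_zero_right, h1,
    real_inner_comm, h2, r₁_sq] at e2
  -- The Gram matrix has equal diagonal entries, so the sum and the difference of the two equations
  -- isolate `s + t` and `s - t`; the latter has coefficient `(5 + √5)/8 - (1 + √5)/8 = 1/2`.
  have e3 : (s + t) * (6 + 2 * √5) = 0 := by linear_combination 8 * e1 + 8 * e2
  have e4 : s + t = 0 := (mul_eq_zero.1 e3).resolve_right (by positivity)
  have e5 : s = t := by linear_combination 2 * (e1 - e2)
  constructor <;> linarith

/-- The image of `k` has prescribed length and inner products with two independent vectors. Two of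
the 732 points meet these conditions, and there is no room for a third. -/
theorem exists_pt_of_glue {f : E3 ≃ₗᵢ[ℝ] E3} {i j : Fin 9} (hij : L91.Adj i j) {v : ℕ}
    (hv : v ∈ [1, 4]) (h1 : f (pt91 i) = pt 0) (h2 : f (pt91 j) = pt v) (k : Fin 9) :
    ∃ y < 732, f (pt91 k) = pt y := by
  have hv' : v < 732 := by
    simp only [List.mem_cons, List.not_mem_nil, or_false] at hv
    omega
  obtain ⟨⟨y₁, y₂⟩, hy⟩ := exists_of_allMatched gluedPairs_spec (a := (v, (i, j), k)) (by
    simp only [List.mem_flatMap, List.mem_map, List.mem_range]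
    exact ⟨v, hv, (i, j), (mem_edges91 i j).2 hij, k, k.2, rfl⟩)
  simp only [imagesOf, Bool.or_eq_true, beq_iff_eq, Bool.and_eq_true, bne_iff_ne,
    decide_eq_true_eq, Fin.val_inj] at hy
  rcases hy with (rfl | rfl) | ⟨⟨⟨⟨⟨⟨hne, hy1⟩, hy2⟩, a1⟩, a2⟩, b1⟩, b2⟩
  · exact ⟨0, by norm_num, h1⟩
  · exact ⟨v, hv', h2⟩
  · have ha : inner ℝ (f (pt91 k)) (pt 0) = inner ℝ (pt (idx91 k)) (pt (idx91 i)) := by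
      rw [← h1, f.inner_map_map, pt91_eq, pt91_eq]
    have hb : inner ℝ (f (pt91 k)) (pt v) = inner ℝ (pt (idx91 k)) (pt (idx91 j)) := by
      rw [← h2, f.inner_map_map, pt91_eq, pt91_eq]
    have hn : ‖f (pt91 k)‖ = r₁ := by rw [f.norm_map, pt91_eq, norm_pt (idx91_lt k)]
    rcases eq_or_eq_of_inner_eq (finrank_euclideanSpace_fin) (linearIndependent_pt hv)
      (fun h => hne (pt_injOn hy1 hy2 h)) ((norm_pt hy1).trans hn.symm)
      ((norm_pt hy2).trans hn.symm) ((inner_pt_eq a1).trans ha.symm)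
      ((inner_pt_eq a2).trans ha.symm) ((inner_pt_eq b1).trans hb.symm)
      ((inner_pt_eq b2).trans hb.symm) with h | h
    exacts [⟨y₁, hy1, h⟩, ⟨y₂, hy2, h⟩]

theorem exists_pt_of_mem {x : E3} (hx : x ∈ productGraph.verts) : ∃ n < 732, x = pt n := by
  obtain ⟨f, ⟨u₁, v₁, u₂, v₂, hu, hw, hf⟩, k, rfl⟩ := mem_productGraph_verts.1 hx
  obtain ⟨a, ha, b, hb, rfl, rfl, hab⟩ := H121_adj.1 hu
  obtain ⟨i, j, hij, rfl, rfl⟩ := H91_adj.1 hw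
  have key (t : Pyr) (v : ℕ) (hv : v ∈ [1, 4]) (i j : Fin 9) (hij : L91.Adj i j)
      (h1 : f (pt91 i) = t.iso (pt 0)) (h2 : f (pt91 j) = t.iso (pt v)) :
      ∃ n < 732, f (pt91 k) = pt n := by
    obtain ⟨y, hy, h⟩ := exists_pt_of_glue (f := f.trans t.iso.symm) hij hv (by simp [h1])
      (by simp [h2]) k
    refine ⟨actIdx t y, actIdx_lt (k := 30) _ hy, ?_⟩
    rw [pt_actIdx, ← h]
    simp
  obtain ⟨t, v, hv, ⟨h0, h1⟩ | ⟨h0, h1⟩⟩ := exists_edge_eq ha hb hab <;>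
    rcases hf with ⟨hf, hf'⟩ | ⟨hf, hf'⟩
  · exact key t v hv i j hij (hf.trans h0) (hf'.trans h1)
  · exact key t v hv j i hij.symm (hf'.trans h0) (hf.trans h1)
  · exact key t v hv j i hij.symm (hf'.trans h0) (hf.trans h1)
  · exact key t v hv i j hij (hf.trans h0) (hf'.trans h1)

theorem mem_productGraph_iff {x : E3} : x ∈ productGraph.verts ↔ ∃ n < 732, x = pt n := by
  refine ⟨exists_pt_of_mem, ?_⟩
  rintro ⟨n, hn, rfl⟩
  exact pt_mem_productGraph hn

end Product

/-! ### Adjacency, degrees and symmetries of the distance product -/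

section Structure

theorem actIdx_injOn (t : Pyr) {n m : ℕ} (hn : n < 732) (hm : m < 732)
    (h : actIdx t n = actIdx t m) : n = m := by
  refine pt_injOn hn hm (t.iso.injective ?_)
  rw [← pt_actIdx, ← pt_actIdx, h]

theorem nodup_nbrs {n : ℕ} (hn : n < 732) : (nbrs n).Nodup := by
  rw [nbrs_eq hn]
  refine List.Nodup.map_on (fun x hx y hy h => ?_) (List.nodup_range.filter _)
  simp only [List.mem_filter, List.mem_range] at hx hy
  exact actIdx_injOn _ hx.1 hy.1 h

/-- The points with numbers below `N`, with all edges between them. -/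
def IsInitialGraph (N : ℕ) (G : DistGraph) : Prop :=
  (∀ x, x ∈ G.verts ↔ ∃ n < N, x = pt n) ∧
    ∀ u v, G.Adj u v ↔ u ∈ G.verts ∧ v ∈ G.verts ∧ dist u v = 1

variable {N : ℕ} {G : DistGraph}

theorem IsInitialGraph.adj_pt (h : IsInitialGraph N G) (hN : N ≤ 732) {n m : ℕ} (hn : n < N) :
    G.Adj (pt n) (pt m) ∧ m < 732 ↔ m ∈ nbrs n ∧ m < N := by
  rw [h.2, mem_nbrs (hn.trans_le hN)]
  constructor
  · rintro ⟨⟨-, h2, h3⟩, hm⟩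
    obtain ⟨k, hk, hkm⟩ := (h.1 _).1 h2
    obtain rfl := pt_injOn hm (hk.trans_le hN) hkm
    exact ⟨⟨hm, h3⟩, hk⟩
  · rintro ⟨⟨hm, h3⟩, hk⟩
    exact ⟨⟨(h.1 _).2 ⟨n, hn, rfl⟩, (h.1 _).2 ⟨m, hk, rfl⟩, h3⟩, hm⟩

theorem IsInitialGraph.encard_verts (h : IsInitialGraph N G) (hN : N ≤ 732) :
    G.verts.encard = N := by
  have h1 : G.verts = pt '' (Finset.range N : Set ℕ) := by
    ext x
    simp [h.1, eq_comm]
  rw [h1, Set.InjOn.encard_image, Set.encard_coe_eq_coe_finsetCard, Finset.card_range]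
  intro a ha b hb hab
  simp only [Finset.coe_range, Set.mem_Iio] at ha hb
  exact pt_injOn (ha.trans_le hN) (hb.trans_le hN) hab

theorem IsInitialGraph.encard_neighborSet (h : IsInitialGraph N G) (hN : N ≤ 732) {n : ℕ}
    (hn : n < N) : (G.neighborSet (pt n)).encard = (nbrs n).countP (· < N) := by
  have h1 : G.neighborSet (pt n) = pt '' (((nbrs n).filter (· < N)).toFinset : Set ℕ) := by
    ext x
    simp only [SimpleGraph.Subgraph.mem_neighborSet, List.coe_toFinset, List.mem_filter,
      decide_eq_true_eq, Set.mem_image, Set.mem_ofPred_eq]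
    constructor
    · intro hx
      obtain ⟨m, hm, rfl⟩ := (h.1 x).1 ((h.2 _ _).1 hx).2.1
      exact ⟨m, (h.adj_pt hN hn).1 ⟨hx, hm.trans_le hN⟩, rfl⟩
    · rintro ⟨m, hm, rfl⟩
      exact ((h.adj_pt hN hn).2 hm).1
  rw [h1, Set.InjOn.encard_image, Set.encard_coe_eq_coe_finsetCard, List.toFinset_card_of_nodup
    ((nodup_nbrs (hn.trans_le hN)).filter _), List.countP_eq_length_filter]
  intro a ha b hb hab
  simp only [List.coe_toFinset, List.mem_filter, decide_eq_true_eq, Set.mem_ofPred_eq] at ha hb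
  exact pt_injOn (ha.2.trans_le hN) (hb.2.trans_le hN) hab

/-- The graph is copied to `Fin N`, where the sum of the degrees is twice the number of edges. -/
theorem IsInitialGraph.encard_edgeSet (h : IsInitialGraph N G) (hN : N ≤ 732) {k : ℕ}
    (hk : ∑ n ∈ Finset.range N, (nbrs n).countP (· < N) = 2 * k) : G.edgeSet.encard = k := by
  classical
  let e : Fin N → E3 := fun i => pt i
  have he : Function.Injective e := fun i j hij =>
    Fin.ext (pt_injOn (i.2.trans_le hN) (j.2.trans_le hN) hij)
  let H : SimpleGraph (Fin N) := G.spanningCoe.comap e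
  have h1 : G.edgeSet = Sym2.map e '' H.edgeSet := by
    ext x
    constructor
    · induction x with
      | h u v =>
        intro huv
        have huv : G.Adj u v := huv
        obtain ⟨n, hn, rfl⟩ := (h.1 u).1 huv.fst_mem
        obtain ⟨m, hm, rfl⟩ := (h.1 v).1 huv.snd_mem
        exact ⟨s(⟨n, hn⟩, ⟨m, hm⟩), huv, rfl⟩
    · rintro ⟨y, hy, rfl⟩
      induction y with
      | h i j => exact hy
  have h2 (i : Fin N) : H.degree i = (nbrs i).countP (· < N) := by
    rw [← Nat.cast_inj (R := ℕ∞), ← h.encard_neighborSet hN i.2]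
    have h3 : G.neighborSet (pt i) = e '' (H.neighborFinset i : Set (Fin N)) := by
      ext x
      simp only [SimpleGraph.Subgraph.mem_neighborSet, SimpleGraph.coe_neighborFinset,
        Set.mem_image, SimpleGraph.mem_neighborSet]
      constructor
      · intro hx
        obtain ⟨m, hm, rfl⟩ := (h.1 x).1 ((h.2 _ _).1 hx).2.1
        exact ⟨⟨m, hm⟩, hx, rfl⟩
      · rintro ⟨m, hm, rfl⟩
        exact hm
    rw [h3, he.encard_image, Set.encard_coe_eq_coe_finsetCard, SimpleGraph.card_neighborFinset_eq_degree]
  rw [← Fin.sum_univ_eq_sum_range (fun n => (nbrs n).countP (· < N)),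
    ← Finset.sum_congr rfl fun i _ => h2 i, SimpleGraph.sum_degrees_eq_twice_card_edges] at hk
  rw [h1, (Sym2.map.injective he).encard_image, ← SimpleGraph.coe_edgeFinset,
    Set.encard_coe_eq_coe_finsetCard, Nat.eq_of_mul_eq_mul_left two_pos hk]

theorem countP_nbrs {n : ℕ} (hn : n < 732) : (nbrs n).countP (· < 732) =
    if n < 12 then 35 else if n < 132 then 12 else if n < 372 then 11 else
      if n < 492 then 7 else 6 := by
  have h1 : (nbrs n).countP (· < 732) = (nbrs n).length :=
    List.countP_eq_length.2 fun m hm => by simpa using ((mem_nbrs hn).1 hm).1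
  rw [h1]
  revert n
  have key : ((List.range 732).all fun n => (nbrs n).length = if n < 12 then 35 else
      if n < 132 then 12 else if n < 372 then 11 else if n < 492 then 7 else 6) = true := by
    decide +kernel
  intro n hn _
  simpa using List.all_eq_true.1 key n (List.mem_range.2 hn)

theorem countP_nbrs_lt {n : ℕ} (hn : n < 372) : (nbrs n).countP (· < 372) =
    if n < 12 then 35 else if n < 132 then 9 else 8 := by
  have key : ((List.range 372).all fun n => (nbrs n).countP (· < 372) = if n < 12 then 35 else
      if n < 132 then 9 else 8) = true := by
    decide +kernel
  simpa using List.all_eq_true.1 key n (List.mem_range.2 hn)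

theorem isInitialGraph_productGraph : IsInitialGraph 732 productGraph :=
  ⟨fun _ => mem_productGraph_iff, fun _ _ => Iff.rfl⟩

/-- By the ordering of `basePoints`, degree at least 8 in the product means a number below 372. -/
theorem isInitialGraph_G372 : IsInitialGraph 372 G372 := by
  have h1 (x : E3) : x ∈ G372.verts ↔ ∃ n < 372, x = pt n := by
    rw [G372, SimpleGraph.Subgraph.deleteVerts_verts, Set.mem_sdiff, mem_productGraph_iff,
      Set.mem_ofPred_eq, not_le]
    constructor
    · rintro ⟨⟨n, hn, rfl⟩, hd⟩
      refine ⟨n, ?_, rfl⟩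
      rw [isInitialGraph_productGraph.encard_neighborSet le_rfl hn, countP_nbrs hn] at hd
      by_contra h
      rw [if_neg (by omega), if_neg (by omega), if_neg h] at hd
      split_ifs at hd <;> exact absurd hd (by norm_num)
    · rintro ⟨n, hn, rfl⟩
      have hn' : n < 732 := hn.trans (by norm_num)
      refine ⟨⟨n, hn', rfl⟩, ?_⟩
      rw [isInitialGraph_productGraph.encard_neighborSet le_rfl hn', countP_nbrs hn']
      split_ifs <;> norm_num
  refine ⟨h1, fun u v => ?_⟩
  rw [G372, SimpleGraph.Subgraph.deleteVerts_adj, SimpleGraph.Subgraph.deleteVerts_verts,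
    Set.mem_sdiff, Set.mem_sdiff, isInitialGraph_productGraph.2]
  tauto

/-- If `g` glues an edge to an icosahedron edge, then `g` followed by `f` glues it to the image
edge. -/
theorem mem_productGraph_of_symm {f : E3 ≃ₗᵢ[ℝ] E3}
    (hf : (fun x => f x) '' icosahedronVertices = icosahedronVertices) {x : E3}
    (hx : x ∈ productGraph.verts) : f x ∈ productGraph.verts := by
  obtain ⟨g, ⟨u₁, v₁, u₂, v₂, hu, hw, hg⟩, k, rfl⟩ := mem_productGraph_verts.1 hx
  have hu : u₁ ∈ icosahedronVertices ∧ v₁ ∈ icosahedronVertices ∧ dist u₁ v₁ = 1 := hu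
  have hico {y : E3} (hy : y ∈ icosahedronVertices) : f y ∈ icosahedronVertices :=
    hf ▸ Set.mem_image_of_mem _ hy
  refine mem_productGraph_verts.2 ⟨g.trans f, ⟨f u₁, f v₁, u₂, v₂, ⟨hico hu.1, hico hu.2.1,
    (f.dist_map _ _).trans hu.2.2⟩, hw, ?_⟩, k, rfl⟩
  rcases hg with ⟨h1, h2⟩ | ⟨h1, h2⟩
  · exact Or.inl ⟨congrArg f h1, congrArg f h2⟩
  · exact Or.inr ⟨congrArg f h1, congrArg f h2⟩

theorem symm_image_icosahedronVertices {f : E3 ≃ₗᵢ[ℝ] E3}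
    (hf : (fun x => f x) '' icosahedronVertices = icosahedronVertices) :
    (fun x => f.symm x) '' icosahedronVertices = icosahedronVertices := by
  nth_rw 1 [← hf]
  simp [Set.image_image]

/-- The inequality suffices: degree at least 8 is preserved by `f`, and equally by its inverse. -/
theorem encard_neighborSet_le_of_symm {f : E3 ≃ₗᵢ[ℝ] E3}
    (hf : (fun x => f x) '' icosahedronVertices = icosahedronVertices) (x : E3) :
    (productGraph.neighborSet x).encard ≤ (productGraph.neighborSet (f x)).encard := by
  rw [← f.injective.encard_image]
  refine Set.encard_le_encard ?_
  rintro _ ⟨y, hy, rfl⟩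
  obtain ⟨h1, h2, h3⟩ := (isInitialGraph_productGraph.2 _ _).1 hy
  exact (isInitialGraph_productGraph.2 _ _).2 ⟨mem_productGraph_of_symm hf h1,
    mem_productGraph_of_symm hf h2, (f.dist_map _ _).trans h3⟩

theorem mem_G372_of_symm {f : E3 ≃ₗᵢ[ℝ] E3}
    (hf : (fun x => f x) '' icosahedronVertices = icosahedronVertices) {x : E3}
    (hx : x ∈ G372.verts) : f x ∈ G372.verts := by
  rw [G372, SimpleGraph.Subgraph.deleteVerts_verts, Set.mem_sdiff, Set.mem_ofPred_eq, not_le] at hx ⊢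
  exact ⟨mem_productGraph_of_symm hf hx.1, hx.2.trans_le (encard_neighborSet_le_of_symm hf x)⟩

theorem image_G372_of_symm {f : E3 ≃ₗᵢ[ℝ] E3}
    (hf : (fun x => f x) '' icosahedronVertices = icosahedronVertices) :
    (fun x => f x) '' G372.verts = G372.verts := by
  refine Set.Subset.antisymm ?_ fun x hx => ?_
  · rintro _ ⟨x, hx, rfl⟩
    exact mem_G372_of_symm hf hx
  · exact ⟨f.symm x, mem_G372_of_symm (symm_image_icosahedronVertices hf) hx, f.apply_symm_apply x⟩

end Structure

/-! ### Colourings -/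

section Colorings

/-- The binary ones of this number are the neighbours below 372 of the given point. -/
def rowMask (v : ℕ) : ℕ :=
  (nbrs v).foldl (fun acc m => if m < 372 then acc ||| 1 <<< m else acc) 0

theorem testBit_foldl_or (l : List ℕ) (x w : ℕ)
    (h : (l.foldl (fun acc m => if m < 372 then acc ||| 1 <<< m else acc) x).testBit w = true) :
    x.testBit w = true ∨ w ∈ l := by
  induction l generalizing x with
  | nil => exact Or.inl h
  | cons m l ih =>
    rw [List.foldl_cons] at h
    rcases ih _ h with h | h
    · split_ifs at h
      · rw [Nat.testBit_or, Nat.one_shiftLeft, Nat.testBit_two_pow, Bool.or_eq_true,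
          decide_eq_true_eq] at h
        rcases h with h | rfl
        · exact Or.inl h
        · exact Or.inr List.mem_cons_self
      · exact Or.inl h
    · exact Or.inr (List.mem_cons_of_mem _ h)

theorem mem_nbrs_of_testBit_rowMask {v w : ℕ} (h : (rowMask v).testBit w = true) : w ∈ nbrs v :=
  (testBit_foldl_or _ _ _ h).resolve_left (by simp)

/-- The function `f` is a proper colouring of the first 372 points. -/
def IsProper (f : ℕ → Fin 4) : Prop := ∀ v < 372, ∀ w < 372, w ∈ nbrs v → f v ≠ f w

/-- The group permutes the first 372 = 12 + 24 · 15 points, since these are full orbits. -/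
theorem IsProper.comp_actIdx {f : ℕ → Fin 4} (hf : IsProper f) (t : Pyr) :
    IsProper fun n => f (actIdx t n) := by
  intro v hv w hw h
  have hv' : v < 732 := hv.trans (by norm_num)
  refine hf _ (actIdx_lt (k := 15) t hv) _ (actIdx_lt (k := 15) t hw) ?_
  rw [mem_nbrs (actIdx_lt (k := 30) t hv'), pt_actIdx, pt_actIdx, LinearIsometryEquiv.dist_map]
  rw [mem_nbrs hv'] at h
  exact ⟨actIdx_lt (k := 30) t h.1, h.2⟩

theorem IsProper.perm_comp {f : ℕ → Fin 4} (hf : IsProper f) (σ : Equiv.Perm (Fin 4)) :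
    IsProper fun n => σ (f n) :=
  fun v hv w hw h => σ.injective.ne (hf v hv w hw h)

/-- The binary ones of `m` include all positions below 372, except for positions below 12 at which
`l` does not have the entry `k`. -/
def allows (l : List ℕ) (k m : ℕ) : Bool :=
  (List.range 372).all fun v => m.testBit v || (decide (v < 12) && l.getD v 0 != k)

theorem testBit_of_allows {l : List ℕ} {f : ℕ → Fin 4} (hl : ∀ v < 12, f v = l.getD v 0)
    {m : ℕ} {k : Fin 4} (h : allows l k m = true) {v : ℕ} (hv : v < 372) (hk : f v = k) :
    m.testBit v = true := by
  have h1 := List.all_eq_true.1 h v (List.mem_range.2 hv)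
  simp only [Bool.or_eq_true, Bool.and_eq_true, decide_eq_true_eq, bne_iff_ne] at h1
  rcases h1 with h1 | ⟨h1, h2⟩
  · exact h1
  · exact absurd ((hl v h1).symm.trans (congrArg Fin.val hk)) h2

set_option exponentiation.threshold 400 in
theorem IsProper.false_of_refute {f : ℕ → Fin 4} (hf : IsProper f) {l : List ℕ}
    {fuel cert a b c d t : ℕ}
    (h : refute 372 (2 ^ 372 - 1) rowMask fuel cert a b c d t ≠ 0)
    (hm : (allows l 0 a && allows l 1 b && allows l 2 c && allows l 3 d) = true)
    (hl : ∀ v < 12, f v = l.getD v 0) : False := by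
  simp only [Bool.and_eq_true] at hm
  obtain ⟨⟨⟨ha, hb⟩, hc⟩, hd⟩ := hm
  refine not_compatible_of_refute (fun v hv => ?_)
    (fun v hv w hw hvw => hf v hv w hw (mem_nbrs_of_testBit_rowMask hvw)) h
    fun v hv => ⟨testBit_of_allows hl ha hv, testBit_of_allows hl hb hv,
      testBit_of_allows hl hc hv, testBit_of_allows hl hd hv⟩
  rw [Nat.testBit_two_pow_sub_one] at hv
  simpa using hv

/-! ### Four-colourings of the icosahedron and their extensions to `G372`. -/

/-- A colouring of the icosahedron with four colours, the entries being the colours of the points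
below 12. -/
def coloringA : List ℕ := [0, 1, 0, 2, 1, 3, 0, 3, 2, 3, 2, 1]

/-- The branching vertices of the search for an extension of `coloringA`. -/
def coloringABranching : ℕ :=
  32172317920566115635039768748918189805255426178542734861098453024274346687904792647720562470165002578327126754836767858910662747696627384071728383611077740789484679490159858604486093109122763794265464352120092769089280997095696872666795117170668922967846718937160372858949385345358066292542518049790114872770557402483472067216949828716427253672595467493129983969073720832408152253428244977825370504209800497289694949988283832035434662649572025175288198794361815993429088720670621408815426310436314762240245457149562144754266454870595353537690125663061039181502392742815980488138753913829368657464214604841942811666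

theorem refute_coloringA : refute 372 (2 ^ 372 - 1) rowMask 400 coloringABranching
    -- Each of the four numbers is `2 ^ 372 - 2 ^ 12` plus the mask of one colour class of
    -- `coloringA`: outside the icosahedron every colour is allowed. The last argument says that no
    -- vertex has been propagated yet.
    9619630419041620901435312524449124464130795720328478190417063819395928166869436184427311097384012607618805657669
    9619630419041620901435312524449124464130795720328478190417063819395928166869436184427311097384012607618805659666
    9619630419041620901435312524449124464130795720328478190417063819395928166869436184427311097384012607618805658888
    9619630419041620901435312524449124464130795720328478190417063819395928166869436184427311097384012607618805658272
    (2 ^ 372 - 1) ≠ 0 := by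
  decide +kernel

theorem IsProper.false_of_coloringA {f : ℕ → Fin 4} (hf : IsProper f)
    (hl : ∀ v < 12, f v = coloringA.getD v 0) : False :=
  hf.false_of_refute refute_coloringA (by decide +kernel) hl

/-- A colouring of the icosahedron with four colours that is not equivalent to `coloringA` under the
pyritohedral group and permutations of the colours. -/
def coloringB : List ℕ := [0, 1, 2, 3, 1, 3, 2, 0, 3, 0, 2, 1]

/-- The branching vertices of the search for an extension of `coloringB`. -/
def coloringBBranching : ℕ :=
  158881882540637267117720837663131980990967178995837602550519661880009111657806314361182302169921952430703895715334697246753538698820648745475698998447632558281740585413816495925576404280286489586729413911385456216655772182004937109566829538229537152858900758670845353533799229157345243055832758153594341607328304596086768293853687868535089649018406958636393348617877757483781865164306574196759560363977207875472888755066409812461234432041866438829323553714926512184879131470905914517318554459293436144399010064104348560586799872016424361801233804103038635165771079688356541225422792451110986377131855364225247988146330100368432680301000716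

theorem refute_coloringB : refute 372 (2 ^ 372 - 1) rowMask 400 coloringBBranching
    9619630419041620901435312524449124464130795720328478190417063819395928166869436184427311097384012607618805658241
    9619630419041620901435312524449124464130795720328478190417063819395928166869436184427311097384012607618805659666
    9619630419041620901435312524449124464130795720328478190417063819395928166869436184427311097384012607618805658692
    9619630419041620901435312524449124464130795720328478190417063819395928166869436184427311097384012607618805657896
    (2 ^ 372 - 1) ≠ 0 := by
  decide +kernel

theorem IsProper.false_of_coloringB {f : ℕ → Fin 4} (hf : IsProper f)
    (hl : ∀ v < 12, f v = coloringB.getD v 0) : False :=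
  hf.false_of_refute refute_coloringB (by decide +kernel) hl

/-- After composition with `t` and a permutation of the colours, the colouring `x` has the given
colours. -/
def agrees (x : List (Fin 4)) (l : List ℕ) (t : Pyr) : Bool :=
  (List.range 12).all fun i =>
    decide (x.getD (actIdx t i) 0 = x.getD (actIdx t 0) 0 ↔ l.getD i 0 = 0) &&
    decide (x.getD (actIdx t i) 0 = x.getD (actIdx t 4) 0 ↔ l.getD i 0 = 1) &&
    decide (x.getD (actIdx t i) 0 = x.getD (actIdx t 5) 0 ↔ l.getD i 0 = 3)

-- The triangle 0, 4, 5 is normalized to the colours 0, 1, 3. Each further vertex is quantified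
-- together with its constraints from earlier ones, so partial colourings are pruned at once.
set_option synthInstance.maxSize 1000 in
set_option synthInstance.maxHeartbeats 400000 in
theorem icosahedron_colorings :
    ∀ x8 : Fin 4, x8 ≠ 0 → x8 ≠ 1 → 
    ∀ x10 : Fin 4, x10 ≠ 0 → x10 ≠ 3 → 
    ∀ x1 : Fin 4, x1 ≠ 0 → x1 ≠ x8 → x1 ≠ x10 → 
    ∀ x9 : Fin 4, x9 ≠ 1 → x9 ≠ x8 → 
    ∀ x6 : Fin 4, x6 ≠ x8 → x6 ≠ x1 → x6 ≠ x9 → 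
    ∀ x2 : Fin 4, x2 ≠ 1 → x2 ≠ 3 → x2 ≠ x9 → 
    ∀ x11 : Fin 4, x11 ≠ 3 → x11 ≠ x10 → x11 ≠ x2 → 
    ∀ x3 : Fin 4, x3 ≠ x9 → x3 ≠ x6 → x3 ≠ x2 → x3 ≠ x11 → 
    ∀ x7 : Fin 4, x7 ≠ x10 → x7 ≠ x1 → x7 ≠ x6 → x7 ≠ x11 → x7 ≠ x3 → 
    ((List.range 24).any fun e =>
      agrees [0, x1, x2, x3, 1, 3, x6, x7, x8, x9, x10, x11] coloringA (Pyr.dec e) ||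
      agrees [0, x1, x2, x3, 1, 3, x6, x7, x8, x9, x10, x11] coloringB (Pyr.dec e)) = true := by
  decide +kernel

theorem exists_perm (a b c : Fin 4) (hab : a ≠ b) (hac : a ≠ c) (hbc : b ≠ c) :
    ∃ σ : Equiv.Perm (Fin 4), σ a = 0 ∧ σ b = 1 ∧ σ c = 3 := by
  revert a b c
  decide +kernel

theorem IsProper.exists_perm {f : ℕ → Fin 4} (hf : IsProper f) :
    ∃ σ : Equiv.Perm (Fin 4), σ (f 0) = 0 ∧ σ (f 4) = 1 ∧ σ (f 5) = 3 :=
  _root_.exists_perm _ _ _ (hf 0 (by norm_num) 4 (by norm_num) (by decide +kernel))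
    (hf 0 (by norm_num) 5 (by norm_num) (by decide +kernel))
    (hf 4 (by norm_num) 5 (by norm_num) (by decide +kernel))

/-- In both model colourings the triangle 0, 4, 5 has the colours 0, 1, 3. These fix the permutation
`σ`, and `agrees` compares the three colour classes; the class of colour 2 is what remains. -/
theorem IsProper.eq_of_agrees {f : ℕ → Fin 4} (hf : IsProper f) {x : List (Fin 4)}
    (hx : ∀ i < 12, x.getD i 0 = f i) {l : List ℕ} (hl : ∀ i < 12, l.getD i 0 < 4) {t : Pyr}
    (h : agrees x l t = true) :
    ∃ g : ℕ → Fin 4, IsProper g ∧ ∀ i < 12, g i = l.getD i 0 := by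
  obtain ⟨σ, h0, h4, h5⟩ := (hf.comp_actIdx t).exists_perm
  refine ⟨_, (hf.comp_actIdx t).perm_comp σ, fun i hi => ?_⟩
  have h1 := List.all_eq_true.1 h i (List.mem_range.2 hi)
  have hx' (j : ℕ) (hj : j < 12) : x.getD (actIdx t j) 0 = f (actIdx t j) :=
    hx _ (actIdx_lt (k := 0) t hj)
  simp only [Bool.and_eq_true, decide_eq_true_eq] at h1
  rw [hx' i hi, hx' 0 (by norm_num), hx' 4 (by norm_num), hx' 5 (by norm_num),
    ← σ.injective.eq_iff (b := f (actIdx t 0)),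
    ← σ.injective.eq_iff (b := f (actIdx t 4)), ← σ.injective.eq_iff (b := f (actIdx t 5)), h0, h4, h5, Fin.ext_iff,
    Fin.ext_iff, Fin.ext_iff] at h1
  have h2 := hl i hi
  have h3 := (σ (f (actIdx t i))).2
  simp only [Fin.isValue, Fin.coe_ofNat_eq_mod] at h1
  omega

theorem not_isProper (f : ℕ → Fin 4) : ¬IsProper f := by
  intro hf
  -- Permuting the colours achieves the normalization assumed in `icosahedron_colorings`.
  obtain ⟨σ, h0, h4, h5⟩ := hf.exists_perm
  replace hf := hf.perm_comp σ
  generalize hg : (fun n => σ (f n)) = g at hf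
  replace h0 : g 0 = 0 := by rw [← hg, ← h0]
  replace h4 : g 4 = 1 := by rw [← hg, ← h4]
  replace h5 : g 5 = 3 := by rw [← hg, ← h5]
  have e (i j : ℕ) (hi : i < 12 := by norm_num) (hj : j < 12 := by norm_num)
      (h : (nbrs i).contains j = true := by decide +kernel) : g i ≠ g j :=
    hf i (hi.trans (by norm_num)) j (hj.trans (by norm_num)) (by simpa using h)
  obtain ⟨r, -, hr⟩ := List.any_eq_true.1 (icosahedron_colorings
    (g 8) (h0 ▸ e 8 0) (h4 ▸ e 8 4)
    (g 10) (h0 ▸ e 10 0) (h5 ▸ e 10 5)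
    (g 1) (h0 ▸ e 1 0) (e 1 8) (e 1 10)
    (g 9) (h4 ▸ e 9 4) (e 9 8)
    (g 6) (e 6 8) (e 6 1) (e 6 9)
    (g 2) (h4 ▸ e 2 4) (h5 ▸ e 2 5) (e 2 9)
    (g 11) (h5 ▸ e 11 5) (e 11 10) (e 11 2)
    (g 3) (e 3 9) (e 3 6) (e 3 2) (e 3 11)
    (g 7) (e 7 10) (e 7 1) (e 7 6) (e 7 11) (e 7 3))
  have hx : ∀ i < 12, [0, g 1, g 2, g 3, 1, 3, g 6, g 7, g 8, g 9, g 10, g 11].getD i 0 = g i := by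
    intro i hi
    interval_cases i <;> simp [h0, h4, h5]
  rw [Bool.or_eq_true] at hr
  rcases hr with hr | hr
  · obtain ⟨g', hg', h⟩ := hf.eq_of_agrees hx (by decide) hr
    exact hg'.false_of_coloringA h
  · obtain ⟨g', hg', h⟩ := hf.eq_of_agrees hx (by decide) hr
    exact hg'.false_of_coloringB h

/-- The octal digits of this number are the colours of a colouring of the points with five
colours. -/
def fiveColors : ℕ :=
  4941050962943771724974256384680819833360825491887602818094536136881029198013681756434976716609117129948760829406501701478694850198660039776834673970791279805523736419701137374616355976283094709113407931041852929224457110341327254363906319157130409774725022515730388373774257834281113422284165401897866377504132025733049801547748030497577490866853276488899862076406238106244903612316237608069103144188410327241559498667502241667702089279564500174535480244473603072647269577074295146942670262534425438723195377879914299525456729870508122089676862991504695244025767877699775450266828090570731146677935162734589445591712414093564088895401720685980359423967024432656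

/-- The colour of a point. -/
def fiveColor (n : ℕ) : ℕ := (fiveColors >>> (3 * n)) % 8 % 5

theorem fiveColor_ne {n m : ℕ} (hn : n < 732) (hm : m ∈ nbrs n) :
    fiveColor n ≠ fiveColor m := by
  have key : ((List.range 732).all fun n => (nbrs n).all fun m =>
      fiveColor n != fiveColor m) = true := by
    decide +kernel
  simpa using List.all_eq_true.1 (List.all_eq_true.1 key n (List.mem_range.2 hn)) m hm

theorem colorable_productGraph : productGraph.coe.Colorable 5 := by
  have h (x : productGraph.verts) : ∃ n < 732, x.1 = pt n := mem_productGraph_iff.1 x.2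
  choose i hi hpt using h
  refine ⟨SimpleGraph.Coloring.mk (fun x => ⟨fiveColor (i x), Nat.mod_lt _ (by norm_num)⟩) ?_⟩
  intro x y hxy
  have h1 := ((isInitialGraph_productGraph.2 _ _).1 hxy).2.2
  rw [hpt, hpt] at h1
  have h2 := fiveColor_ne (hi x) ((mem_nbrs (hi x)).2 ⟨hi y, h1⟩)
  simpa [Fin.ext_iff] using h2

theorem not_colorable_G372 : ¬G372.coe.Colorable 4 := by
  rintro ⟨C⟩
  have hV (n : ℕ) (hn : n < 372) : pt n ∈ G372.verts := (isInitialGraph_G372.1 _).2 ⟨n, hn, rfl⟩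
  refine not_isProper (fun n => if hn : n < 372 then C ⟨pt n, hV n hn⟩ else 0) ?_
  intro v hv w hw h
  simp only [hv, hw, dif_pos]
  refine C.valid ((isInitialGraph_G372.2 _ _).2 ⟨hV v hv, hV w hw, ?_⟩)
  exact ((mem_nbrs (hv.trans (by norm_num))).1 h).2

theorem G372_le : G372 ≤ productGraph := SimpleGraph.Subgraph.deleteVerts_le

/-- The upper bound is proved for the product and inherited by `G372`; the lower bound goes the
other way. -/
theorem chromaticNumber_productGraph : productGraph.coe.chromaticNumber = 5 :=
  SimpleGraph.chromaticNumber_eq_iff_colorable_not_colorable.2 ⟨colorable_productGraph,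
    fun h => not_colorable_G372 (h.of_hom (SimpleGraph.Subgraph.inclusion G372_le))⟩

theorem chromaticNumber_G372 : G372.coe.chromaticNumber = 5 :=
  SimpleGraph.chromaticNumber_eq_iff_colorable_not_colorable.2
    ⟨colorable_productGraph.of_hom (SimpleGraph.Subgraph.inclusion G372_le), not_colorable_G372⟩

end Colorings

/-! ### Counting edges and degrees, and the conclusion. -/

section Main

theorem idx91_injective : ∀ i j : Fin 9, idx91 i = idx91 j → i = j := by
  decide +kernel

theorem pt91_injective : Function.Injective pt91 := fun i j h =>
  idx91_injective i j (pt_injOn (idx91_lt _) (idx91_lt _) (by rw [← pt91_eq, ← pt91_eq, h]))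

/-- The degree sum is 12·35 + 120·12 + 240·11 + 120·7 + 240·6 = 6780. -/
theorem encard_edgeSet_productGraph : productGraph.edgeSet.encard = 3390 := by
  refine isInitialGraph_productGraph.encard_edgeSet le_rfl ?_
  rw [Finset.sum_congr rfl fun n hn => countP_nbrs (Finset.mem_range.1 hn)]
  decide +kernel

theorem encard_edgeSet_G372 : G372.edgeSet.encard = 1710 := by
  refine isInitialGraph_G372.encard_edgeSet (by norm_num) ?_
  rw [Finset.sum_congr rfl fun n hn => countP_nbrs_lt (Finset.mem_range.1 hn)]
  decide +kernel

theorem le_encard_neighborSet_G372 {v : E3} (hv : v ∈ G372.verts) :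
    8 ≤ (G372.neighborSet v).encard := by
  obtain ⟨n, hn, rfl⟩ := (isInitialGraph_G372.1 v).1 hv
  rw [isInitialGraph_G372.encard_neighborSet (by norm_num) hn, countP_nbrs_lt hn]
  split_ifs <;> norm_num

end Main

theorem mainTheorem4 :
    -- `H₉,₁` is an embedding of `L₉,₁` in the sphere of radius `r₁`
    Function.Injective pt91 ∧
    H91.verts ⊆ Metric.sphere (0 : E3) r₁ ∧
    -- the distance product lies on this sphere and is exactly 5-chromatic
    productGraph.verts ⊆ Metric.sphere (0 : E3) r₁ ∧
    productGraph.coe.chromaticNumber = 5 ∧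
    productGraph.verts.encard = 732 ∧
    productGraph.edgeSet.encard = 3390 ∧
    -- the subgraph `G₃₇₂`
    G372 ≤ productGraph ∧
    G372.verts.encard = 372 ∧
    G372.edgeSet.encard = 1710 ∧
    (∀ v ∈ G372.verts, 8 ≤ (G372.neighborSet v).encard) ∧
    (∀ f : E3 ≃ₗᵢ[ℝ] E3, (fun x => f x) '' icosahedronVertices = icosahedronVertices →
      (fun x => f x) '' G372.verts = G372.verts) ∧
    G372.coe.chromaticNumber = 5 :=
  ⟨pt91_injective,
    by
      rw [H91_verts]
      rintro _ ⟨k, rfl⟩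
      rw [pt91_eq, mem_sphere_zero_iff_norm, norm_pt (idx91_lt k)],
    fun x hx => by
      obtain ⟨n, hn, rfl⟩ := mem_productGraph_iff.1 hx
      rw [mem_sphere_zero_iff_norm, norm_pt hn],
    chromaticNumber_productGraph,
    isInitialGraph_productGraph.encard_verts le_rfl,
    encard_edgeSet_productGraph,
    G372_le,
    isInitialGraph_G372.encard_verts (by norm_num),
    encard_edgeSet_G372,
    fun _ hv => le_encard_neighborSet_G372 hv,
    fun _ hf => image_G372_of_symm hf,
    chromaticNumber_G372⟩
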